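/- **Setting.** All motions are translations of $\mathbb R^d$. A set is a *shape* if it is compact, connected, nonempty and the closure of its interior (for instance a closed topological disk). Two sets overlap only on their boundaries if $A\cap B\subseteq\partial A\cap\partial B$. A *fusion rule* $\mathcal R$ consists, for each $n\ge 0$, of a finite nonempty list of $n$-supertiles $P_n(1),\dots,P_n(j_n)$, where the $P_0(i)$ are labelled shapes (the prototiles), and each $P_{n+1}(j)$ is given as a finite union of translates $P_n(i)+v$ of $n$-supertiles which overlap pairwise only on their boundaries and whose union is connected (a *patch* of $n$-supertiles). Iterating, every $(n+m)$-supertile is decomposed into (translated) $n$-supertiles. Let $X^k_{\mathcal R}$ be the set of tilings of $\mathbb R^d$ by translated $k$-supertiles (covering $\mathbb R^d$, overlapping only on boundaries) such that every patch of $k$-supertiles contained in the tiling is, up to translation, contained in the decomposition of some $(k+m)$-supertile into $k$-supertiles; $X_{\mathcal R}=X^0_{\mathcal R}$ is assumed nonempty. These spaces carry the tiling topology: two tilings are $\epsilon$-close if, after translations of each by vectors of length at most $\epsilon$, the same tiles meet the ball of radius $1/\epsilon$ about the origin. The rule is *strongly primitive* if for every $n\ge1$ each $(n+1)$-supertile contains,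 in its decomposition, a translate of every $n$-supertile; *recognizable* if for every $n\ge 1$ the subdivision map $X^{n}_{\mathcal R}\to X^{n-1}_{\mathcal R}$ is a homeomorphism; *van Hove* if for all $\epsilon,r>0$ there is $n_0$ such that for all $n\ge n_0$ every $n$-supertile with support $A$ satisfies $\mathrm{Vol}(\{x:\mathrm{dist}(x,\partial A)\le r\})<\epsilon\,\mathrm{Vol}(A)$; and it has *finite local complexity* if every tiling in $X_{\mathcal R}$ contains, up to translation, only finitely many connected two-tile patches. A vector $\alpha\in\mathbb R^d$ is a *topological eigenvalue* if there is a continuous $f:X_{\mathcal R}\to S^1\subset\mathbb C$ with $f(T-v)=e^{2\pi i\alpha\cdot v}f(T)$ for all $T\in X_{\mathcal R}$, $v\in\mathbb R^d$. Let $\mathcal V^n$ be the finite set of vectors $v=y-x$ such that $P_n(i)+x$ and $P_n(i)+y$ both occur, for some type $i$, in the decomposition of some $(n+2)$-supertile into $n$-supertiles ($x=y$ is allowed), and let $\eta_n(\alpha)=\max_{v\in\mathcal V^n}|e^{2\pi i\alpha\cdot v}-1|$. **Theorem.** Let $\mathcal R$ be a strongly primitive, recognizable, van Hove fusion rule in $\mathbb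 R^d$ with finite local complexity and with $X_{\mathcal R}\neq\emptyset$. A vector $\alpha\in\mathbb R^d$ is a topological eigenvalue if and only if $\sum_{n}\eta_n(\alpha)$ converges. -/

import Mathlib

open Set
open scoped Pointwise

noncomputable section

/-- Euclidean space `ℝ^d`. -/
abbrev Space (d : ℕ) : Type := EuclideanSpace ℝ (Fin d)

/-- Two sets overlap only on their boundaries. -/
def OverlapOnlyOnBoundary {d : ℕ} (A B : Set (Space d)) : Prop :=
  A ∩ B ⊆ frontier A ∩ frontier B

/-- The combinatorial data of a fusion rule in `ℝ^d`, with translations as the group of motions.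
There are `num n` types of `n`-supertiles, the `0`-supertiles being the prototiles.
The type plays the role of the label, so that geometrically equal prototiles (or supertiles
with the same composition) may be distinguished. -/
structure FusionData (d : ℕ) where
  /-- the number of `n`-supertiles -/
  num : ℕ → ℕ
  /-- the closed set underlying each prototile -/
  shape : Fin (num 0) → Set (Space d)
  /-- the (preferred) way in which an `(n+1)`-supertile is a fusion of `n`-supertiles:
  `(i, v) ∈ parts n j` means that `P_n(i) + v` is one of the fused pieces of `P_{n+1}(j)` -/
  parts : ∀ n, Fin (num (n + 1)) → Finset (Fin (num n) × Space d)

namespace FusionData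

variable {d : ℕ} (R : FusionData d)

/-- A placed `n`-supertile: `(i, v)` stands for `P_n(i) + v`. For `n = 0` this is a tile. -/
abbrev Tile (n : ℕ) : Type := Fin (R.num n) × Space d

/-- The support of the `n`-supertile `P_n(i)`. -/
def supp : ∀ n, Fin (R.num n) → Set (Space d)
  | 0, i => R.shape i
  | n + 1, j => ⋃ p ∈ R.parts n j, p.2 +ᵥ supp n p.1

/-- The support of a placed `n`-supertile. -/
def tileSupp (n : ℕ) (t : R.Tile n) : Set (Space d) := t.2 +ᵥ R.supp n t.1

/-- The support of a collection of placed `n`-supertiles. -/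
def support (n : ℕ) (Q : Set (R.Tile n)) : Set (Space d) := ⋃ t ∈ Q, R.tileSupp n t

/-- Translation of a collection of placed `n`-supertiles by a vector: `Q + v`. -/
def translate (n : ℕ) (v : Space d) (Q : Set (R.Tile n)) : Set (R.Tile n) :=
  (fun t => (t.1, t.2 + v)) '' Q

/-- The members of a collection overlap pairwise only on their boundaries. -/
def NonOverlapping (n : ℕ) (Q : Set (R.Tile n)) : Prop :=
  Q.Pairwise fun s t => OverlapOnlyOnBoundary (R.tileSupp n s) (R.tileSupp n t)

/-- A patch of `n`-supertiles: a connected finite union of (placed) `n`-supertiles that overlap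
only on their boundaries. -/
structure IsPatch (n : ℕ) (Q : Set (R.Tile n)) : Prop where
  finite : Q.Finite
  nonOverlapping : R.NonOverlapping n Q
  connected : IsConnected (R.support n Q)

/-- The collection of `n`-supertiles that make up the `(n+m)`-supertile `P_{n+m}(j)`. -/
def constituents (n : ℕ) : ∀ m, Fin (R.num (n + m)) → Set (R.Tile n)
  | 0, j => {(j, 0)}
  | m + 1, j => ⋃ p ∈ R.parts (n + m) j, R.translate n p.2 (constituents n m p.1)

end FusionData

/-- A fusion rule in `ℝ^d` with translations as the group of motions. Prototiles are compact,
connected sets that are the closure of their nonempty interior. This class of sets contains all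
closed topological disks and is preserved under fusion, so that `n`-supertiles may again be
treated as basic tiles. Each `(n+1)`-supertile is a patch of `n`-supertiles. -/
structure FusionRule (d : ℕ) extends FusionData d where
  num_pos : ∀ n, 0 < num n
  shape_compact : ∀ i, IsCompact (shape i)
  shape_connected : ∀ i, IsConnected (shape i)
  shape_regular : ∀ i, closure (interior (shape i)) = shape i
  parts_isPatch : ∀ n j, toFusionData.IsPatch n (toFusionData.parts n j : Set (toFusionData.Tile n))

namespace FusionRule

variable {d : ℕ} (R : FusionRule d)

/-- A patch of `k`-supertiles is admitted if a copy of it is found inside the decomposition into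
`k`-supertiles of some supertile `P_{k+m}(j)`. -/
def Admitted (k : ℕ) (Q : Set (R.Tile k)) : Prop :=
  ∃ (m : ℕ) (j : Fin (R.num (k + m))) (v : Space d), R.translate k v Q ⊆ R.constituents k m j

/-- A tiling of `ℝ^d` by `k`-supertiles. -/
structure IsTiling (k : ℕ) (T : Set (R.Tile k)) : Prop where
  nonOverlapping : R.NonOverlapping k T
  covers : R.support k T = univ

/-- A fusion tiling by `k`-supertiles: every patch of it is admitted. -/
structure IsFusionTiling (k : ℕ) (T : Set (R.Tile k)) : Prop where
  isTiling : R.IsTiling k T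
  admitted : ∀ Q, Q ⊆ T → R.IsPatch k Q → R.Admitted k Q

/-- The space `X^k` of fusion tilings in which the `k`-supertiles are the smallest building
blocks; `X^0` is the space of all fusion tilings of the rule. -/
def TilingSpace (k : ℕ) : Type := {T : Set (R.Tile k) // R.IsFusionTiling k T}

/-- Two collections agree on `K`: the same members meet `K`. -/
def AgreeOn (k : ℕ) (K : Set (Space d)) (T T' : Set (R.Tile k)) : Prop :=
  ∀ t, (R.tileSupp k t ∩ K).Nonempty → (t ∈ T ↔ t ∈ T')

/-- `ε`-closeness in the "big ball" sense: after translations of size at most `ε` the tilings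
agree on the ball of radius `1/ε` about the origin. -/
def Close (k : ℕ) (ε : ℝ) (T T' : Set (R.Tile k)) : Prop :=
  ∃ g g' : Space d, ‖g‖ ≤ ε ∧ ‖g'‖ ≤ ε ∧
    R.AgreeOn k (Metric.closedBall 0 (1 / ε)) (R.translate k g T) (R.translate k g' T')

theorem Close.mono {k : ℕ} {ε δ : ℝ} (hε : 0 < ε) (h : ε ≤ δ) {T T' : Set (R.Tile k)}
    (hc : R.Close k ε T T') : R.Close k δ T T' := by
  obtain ⟨g, g', hg, hg', ha⟩ := hc
  refine ⟨g, g', hg.trans h, hg'.trans h, fun t ht => ha t (ht.mono ?_)⟩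
  exact inter_subset_inter_right _
    (Metric.closedBall_subset_closedBall (one_div_le_one_div_of_le hε h))

/-- The tiling topology, given by the big ball closeness relation. -/
instance (k : ℕ) : TopologicalSpace (R.TilingSpace k) where
  IsOpen U := ∀ T ∈ U, ∃ ε > 0, ∀ T' : R.TilingSpace k, R.Close k ε T.1 T'.1 → T' ∈ U
  isOpen_univ := fun _ _ => ⟨1, one_pos, fun _ _ => trivial⟩
  isOpen_inter := by
    rintro U V hU hV T ⟨hTU, hTV⟩
    obtain ⟨ε, hε, h⟩ := hU T hTU
    obtain ⟨δ, hδ, h'⟩ := hV T hTV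
    refine ⟨min ε δ, lt_min hε hδ, fun T' hc => ⟨h T' ?_, h' T' ?_⟩⟩
    · exact hc.mono R (lt_min hε hδ) (min_le_left _ _)
    · exact hc.mono R (lt_min hε hδ) (min_le_right _ _)
  isOpen_sUnion := by
    rintro S hS T ⟨U, hU, hT⟩
    obtain ⟨ε, hε, h⟩ := hS U hU T hT
    exact ⟨ε, hε, fun T' hc => ⟨U, hU, h T' hc⟩⟩

/-- The subdivision map: break each `(n+1)`-supertile into `n`-supertiles. -/
def subdivide (n : ℕ) (T : Set (R.Tile (n + 1))) : Set (R.Tile n) :=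
  ⋃ t ∈ T, R.translate n t.2 (R.parts n t.1)

/-- Recognizability: every subdivision map is a homeomorphism from `X^{n+1}` to `X^n`. -/
def Recognizable : Prop :=
  ∀ n, ∃ h : R.TilingSpace (n + 1) ≃ₜ R.TilingSpace n, ∀ T, (h T).1 = R.subdivide n T.1

/-- Strong primitivity: for `n ≥ 1`, each `(n+1)`-supertile contains at least one copy of every
`n`-supertile. -/
def StronglyPrimitive : Prop :=
  ∀ n, 1 ≤ n → ∀ (j : Fin (R.num (n + 1))) (i : Fin (R.num n)), ∃ v, (i, v) ∈ R.parts n j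

/-- The van Hove property: for all `ε, r > 0`, every supertile `A` of sufficiently high level
satisfies `Vol((∂A)^{+r}) < ε Vol(A)`. -/
def VanHove : Prop :=
  ∀ ε > (0 : ℝ), ∀ r > (0 : ℝ), ∃ n₀ : ℕ, ∀ n ≥ n₀, ∀ j : Fin (R.num n),
    MeasureTheory.volume (Metric.cthickening r (frontier (R.supp n j))) <
      ENNReal.ofReal ε * MeasureTheory.volume (R.supp n j)

/-- Finite local complexity: each fusion tiling contains, up to translation, only finitely many
connected two-tile patches. -/
def FiniteLocalComplexity : Prop :=
  ∀ T : R.TilingSpace 0, ∃ F : Set (Set (R.Tile 0)), F.Finite ∧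
    ∀ Q, Q ⊆ T.1 → R.IsPatch 0 Q → Q.ncard = 2 → ∃ Q₀ ∈ F, ∃ v, Q = R.translate 0 v Q₀

theorem translate_translate (k : ℕ) (v w : Space d) (Q : Set (R.Tile k)) :
    R.translate k v (R.translate k w Q) = R.translate k (w + v) Q := by
  simp [FusionData.translate, image_image, add_assoc]

theorem translate_zero (k : ℕ) (Q : Set (R.Tile k)) : R.translate k 0 Q = Q := by
  simp [FusionData.translate]

theorem tileSupp_add (k : ℕ) (t : R.Tile k) (v : Space d) :
    R.tileSupp k (t.1, t.2 + v) = v +ᵥ R.tileSupp k t := by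
  simp [FusionData.tileSupp, vadd_vadd, add_comm]

theorem overlapOnlyOnBoundary_vadd {A B : Set (Space d)} (v : Space d)
    (h : OverlapOnlyOnBoundary A B) : OverlapOnlyOnBoundary (v +ᵥ A) (v +ᵥ B) := by
  have hf : ∀ S : Set (Space d), frontier (v +ᵥ S) = v +ᵥ frontier S := fun S =>
    ((Homeomorph.vadd v).image_frontier S).symm
  unfold OverlapOnlyOnBoundary at *
  rw [hf, hf, ← Set.vadd_set_inter, ← Set.vadd_set_inter]
  exact Set.vadd_set_mono h

theorem nonOverlapping_translate (k : ℕ) (v : Space d) {Q : Set (R.Tile k)}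
    (h : R.NonOverlapping k Q) : R.NonOverlapping k (R.translate k v Q) := by
  rintro _ ⟨s, hs, rfl⟩ _ ⟨t, ht, rfl⟩ hne
  have hst : s ≠ t := fun e => hne (by rw [e])
  have := overlapOnlyOnBoundary_vadd v (h hs ht hst)
  simpa only [tileSupp_add] using this

theorem support_translate (k : ℕ) (v : Space d) (Q : Set (R.Tile k)) :
    R.support k (R.translate k v Q) = v +ᵥ R.support k Q := by
  simp only [FusionData.support, FusionData.translate, biUnion_image, tileSupp_add,
    Set.vadd_set_iUnion]

theorem isPatch_translate (k : ℕ) (v : Space d) {Q : Set (R.Tile k)}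
    (h : R.IsPatch k Q) : R.IsPatch k (R.translate k v Q) where
  finite := h.finite.image _
  nonOverlapping := R.nonOverlapping_translate k v h.nonOverlapping
  connected := by
    rw [support_translate]
    exact h.connected.image _ (continuous_const_vadd v).continuousOn

theorem isFusionTiling_translate (k : ℕ) (v : Space d) {T : Set (R.Tile k)}
    (h : R.IsFusionTiling k T) : R.IsFusionTiling k (R.translate k v T) where
  isTiling :=
    { nonOverlapping := R.nonOverlapping_translate k v h.isTiling.nonOverlapping
      covers := by rw [support_translate, h.isTiling.covers, Set.vadd_set_univ] }
  admitted := by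
    intro Q hQ hP
    have hsub : R.translate k (-v) Q ⊆ T := by
      have h1 : R.translate k (-v) Q ⊆ R.translate k (-v) (R.translate k v T) := image_mono hQ
      rwa [translate_translate, add_neg_cancel, translate_zero] at h1
    obtain ⟨m, j, w, hw⟩ := h.admitted _ hsub (R.isPatch_translate k (-v) hP)
    exact ⟨m, j, -v + w, by rwa [translate_translate] at hw⟩

/-- The translated tiling `T + v`. -/
def shift {k : ℕ} (v : Space d) (T : R.TilingSpace k) : R.TilingSpace k :=
  ⟨R.translate k v T.1, R.isFusionTiling_translate k v T.2⟩

/-- `α` is a topological eigenvalue of the translation action on the tiling space `X^0`: there is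
a continuous `f : X^0 → S^1` with `f (T - v) = exp(2 π i α·v) f(T)` for all `T` and `v`. -/
def IsTopologicalEigenvalue (α : Space d) : Prop :=
  ∃ f : R.TilingSpace 0 → Circle, Continuous f ∧
    ∀ (T : R.TilingSpace 0) (v : Space d),
      (f (R.shift (-v) T) : ℂ) =
        Complex.exp (2 * Real.pi * Complex.I * (inner ℝ α v : ℝ)) * (f T : ℂ)

/-- The return vectors of level `n`: relative positions of two `n`-supertiles of the same type
within an `(n+2)`-supertile. -/
def returnVectors (n : ℕ) : Set (Space d) :=
  {v | ∃ (j : Fin (R.num (n + 2))) (i : Fin (R.num n)) (x y : Space d),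
    (i, x) ∈ R.constituents n 2 j ∧ (i, y) ∈ R.constituents n 2 j ∧ v = y - x}

/-- `η_n(α)`, the maximum of `|exp(2 π i α·v) - 1|` over the finitely many return vectors `v` of
level `n`. -/
def eta (n : ℕ) (α : Space d) : ℝ :=
  sSup ((fun v : Space d => ‖Complex.exp (2 * Real.pi * Complex.I * (inner ℝ α v : ℝ)) - 1‖) ''
    R.returnVectors n)

theorem constituents_finite (n m : ℕ) (j : Fin (R.num (n + m))) :
    (R.constituents n m j).Finite := by
  induction m with
  | zero => exact finite_singleton _
  | succ m ih =>
    exact (R.parts (n + m) j).finite_toSet.biUnion fun p _ => (ih p.1).image _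

theorem returnVectors_finite (n : ℕ) : (R.returnVectors n).Finite := by
  have h : (⋃ j : Fin (R.num (n + 2)),
      (fun q : R.Tile n × R.Tile n => q.2.2 - q.1.2) ''
        (R.constituents n 2 j ×ˢ R.constituents n 2 j)).Finite :=
    finite_iUnion fun j =>
      ((R.constituents_finite n 2 j).prod (R.constituents_finite n 2 j)).image _
  refine h.subset ?_
  rintro v ⟨j, i, x, y, hx, hy, rfl⟩
  exact mem_iUnion.2 ⟨j, ⟨((i, x), (i, y)), ⟨hx, hy⟩, rfl⟩⟩

end FusionRule

end

/-!
The argument compares the phases `exp(2πi α·v)` of relative positions `v` of two supertiles of the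
same type. By recognizability every fusion tiling `T` carries a hierarchy of tilings `level n T`
by `n`-supertiles, and `defect α v = |exp(2πi α·v) - 1|` is subadditive in `v`.

*Summability gives an eigenfunction.* Fix one type of supertile on each level. Two `n`-supertiles of
this type in one fusion tiling lie in a common patch, hence, up to translation, in a common
supertile of some level `n + m`. Climbing the hierarchy from both of them until they share a
supertile, and paying one `eta` for each level, shows that their phases differ by at most a multiple
of the tail `∑_{k ≥ n} eta k` (`defect_climb_le`, `defect_le_tail`). So the phases of these
`n`-supertiles, corrected by fixed offsets between consecutive levels, converge as `n → ∞`, and the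
limit is an eigenfunction. It is continuous because the position of one `n`-supertile determines it
up to the tail, and the map `T ↦ level n T` is continuous.

*An eigenfunction gives summability.* A supertile of high level contains a large ball by the van
Hove property, so the tiling looks the same near corresponding deep points of two supertiles of the
same type. By finite local complexity translates of `T` have limits in the tiling space
(`exists_limit_translates`), and continuity at such a limit forces the defect of all relative
positions of such supertiles, however far apart, to be at most `1` from some level on
(`IsTopologicalEigenvalue.exists_defect_le_one`). By strong primitivity, return vectors `v_k` chosen
independently on every third level, with arbitrary signs, add up to one such relative position
(`exists_sum_returnVectors`). With signs that make the arguments `θ_k` of the phases nonnegative,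
no partial sum of the `θ_k` can leave `[0, π/3]`, because it would have to jump over the arc of
phases at distance more than `1` from `1`. As `eta k = |exp(iθ_k) - 1| ≤ θ_k` for maximal `v_k`, the
series converges along each of the three residue classes (`sum_eta_le`).
-/

noncomputable section

namespace FusionRule

variable {d : ℕ} (R : FusionRule d)

/-! ### Membership in translates, decompositions and supports -/

theorem mem_translate {k : ℕ} {v : Space d} {Q : Set (R.Tile k)} {t : R.Tile k} :
    t ∈ R.translate k v Q ↔ (t.1, t.2 - v) ∈ Q := by
  constructor
  · rintro ⟨s, hs, rfl⟩
    simpa using hs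
  · intro h
    exact ⟨_, h, by simp⟩

theorem mem_subdivide {n : ℕ} {T : Set (R.Tile (n + 1))} {t : R.Tile n} :
    t ∈ R.subdivide n T ↔ ∃ s ∈ T, (t.1, t.2 - s.2) ∈ R.parts n s.1 := by
  simp only [subdivide, mem_iUnion, mem_translate, exists_prop, Finset.mem_coe]

theorem mem_constituents_succ {n m : ℕ} {j : Fin (R.num (n + (m + 1)))} {t : R.Tile n} :
    t ∈ R.constituents n (m + 1) j ↔
      ∃ p ∈ R.parts (n + m) j, (t.1, t.2 - p.2) ∈ R.constituents n m p.1 := by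
  simp only [FusionData.constituents, mem_iUnion, mem_translate, exists_prop]

theorem mem_constituents_zero {n : ℕ} {j : Fin (R.num n)} {t : R.Tile n} :
    t ∈ R.constituents n 0 j ↔ t = (j, 0) := Iff.rfl

theorem mem_constituents_one {n : ℕ} {j : Fin (R.num (n + 1))} {t : R.Tile n} :
    t ∈ R.constituents n 1 j ↔ t ∈ R.parts n j := by
  rw [mem_constituents_succ]
  simp only [mem_constituents_zero, Prod.ext_iff]
  constructor
  · rintro ⟨p, hp, h1, h2⟩
    have : t = p := Prod.ext h1 (sub_eq_zero.1 h2)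
    rwa [this]
  · exact fun h => ⟨t, h, rfl, sub_self _⟩

theorem mem_tileSupp {k : ℕ} {t : R.Tile k} {x : Space d} :
    x ∈ R.tileSupp k t ↔ x - t.2 ∈ R.supp k t.1 := by
  rw [FusionData.tileSupp, Set.mem_vadd_set_iff_neg_vadd_mem, vadd_eq_add, neg_add_eq_sub]

theorem mem_support {k : ℕ} {Q : Set (R.Tile k)} {x : Space d} :
    x ∈ R.support k Q ↔ ∃ t ∈ Q, x ∈ R.tileSupp k t := by
  simp only [FusionData.support, mem_iUnion, exists_prop]

theorem mem_supp_succ {n : ℕ} {j : Fin (R.num (n + 1))} {x : Space d} :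
    x ∈ R.supp (n + 1) j ↔ ∃ p ∈ R.parts n j, x ∈ R.tileSupp n p := by
  simp only [FusionData.supp, mem_iUnion, exists_prop, FusionData.tileSupp]

theorem parts_nonempty (n : ℕ) (j : Fin (R.num (n + 1))) : (R.parts n j).Nonempty := by
  obtain ⟨x, hx⟩ := (R.parts_isPatch n j).connected.nonempty
  obtain ⟨t, ht, -⟩ := (R.mem_support).1 hx
  exact ⟨t, ht⟩

/-! ### Geometry of supertiles -/

theorem isCompact_supp : ∀ (n : ℕ) (i : Fin (R.num n)), IsCompact (R.supp n i)
  | 0, i => R.shape_compact i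
  | n + 1, j => (R.parts n j).isCompact_biUnion fun p _ =>
      (isCompact_supp n p.1).vadd p.2

theorem isConnected_supp : ∀ (n : ℕ) (i : Fin (R.num n)), IsConnected (R.supp n i)
  | 0, i => R.shape_connected i
  | n + 1, j => (R.parts_isPatch n j).connected

theorem interior_supp_nonempty : ∀ (n : ℕ) (i : Fin (R.num n)), (interior (R.supp n i)).Nonempty
  | 0, i => by
    rw [← closure_nonempty_iff]
    exact (R.shape_regular i).symm ▸ (R.shape_connected i).nonempty
  | n + 1, j => by
    obtain ⟨p, hp⟩ := R.parts_nonempty n j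
    obtain ⟨x, hx⟩ := interior_supp_nonempty n p.1
    have hsub : p.2 +ᵥ R.supp n p.1 ⊆ R.supp (n + 1) j := fun y hy =>
      (R.mem_supp_succ).2 ⟨p, hp, hy⟩
    refine ⟨p.2 +ᵥ x, interior_mono hsub ?_⟩
    rw [interior_vadd]
    exact Set.vadd_mem_vadd_set hx

theorem isCompact_tileSupp (n : ℕ) (t : R.Tile n) : IsCompact (R.tileSupp n t) :=
  (R.isCompact_supp n t.1).vadd t.2

theorem isConnected_tileSupp (n : ℕ) (t : R.Tile n) : IsConnected (R.tileSupp n t) :=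
  (R.isConnected_supp n t.1).image _ (continuous_const_vadd t.2).continuousOn

theorem closure_interior_tileSupp (t : R.Tile 0) :
    closure (interior (R.tileSupp 0 t)) = R.tileSupp 0 t := by
  rw [FusionData.tileSupp, interior_vadd, closure_vadd]
  exact congrArg _ (R.shape_regular t.1)

theorem exists_supp_subset_closedBall (n : ℕ) :
    ∃ D > 0, ∀ i, R.supp n i ⊆ Metric.closedBall 0 D := by
  have h : Bornology.IsBounded (⋃ i, R.supp n i) :=
    Bornology.isBounded_iUnion.2 fun i => (R.isCompact_supp n i).isBounded
  obtain ⟨D, hD, h⟩ := h.subset_closedBall_lt 0 0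
  exact ⟨D, hD, fun i => (subset_iUnion _ i).trans h⟩

theorem exists_ball_subset_supp (n : ℕ) :
    ∃ ρ > 0, ∃ c : Fin (R.num n) → Space d, ∀ i, Metric.ball (c i) ρ ⊆ R.supp n i := by
  choose c hc using R.interior_supp_nonempty n
  have h : ∀ i, ∃ ρ > 0, Metric.ball (c i) ρ ⊆ R.supp n i := fun i =>
    Metric.mem_nhds_iff.1 (mem_interior_iff_mem_nhds.1 (hc i))
  choose ρ hρ hb using h
  have : Nonempty (Fin (R.num n)) := ⟨⟨0, R.num_pos n⟩⟩
  obtain ⟨i₀, hi₀⟩ := Finite.exists_min ρ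
  exact ⟨ρ i₀, hρ i₀, c, fun i => (Metric.ball_subset_ball (hi₀ i)).trans (hb i)⟩

/-- A tile that meets the interior of another tile of the collection is equal to it. -/
theorem eq_of_mem_interior_tileSupp {n : ℕ} {Q : Set (R.Tile n)} (hQ : R.NonOverlapping n Q)
    {s t : R.Tile n} (hs : s ∈ Q) (ht : t ∈ Q) {x : Space d} (hxs : x ∈ R.tileSupp n s)
    (hxt : x ∈ interior (R.tileSupp n t)) : s = t := by
  by_contra hne
  exact (hQ hs ht hne ⟨hxs, interior_subset hxt⟩).2.2 hxt

/-- A packing bound, uniform in the position of the ball: the tiles contain disjoint balls of a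
common radius, so only boundedly many of them meet a ball of given radius. -/
theorem exists_card_bound (n : ℕ) (r : ℝ) : ∃ N : ℕ, ∀ (Q : Set (R.Tile n)) (z : Space d),
    R.NonOverlapping n Q → (∀ t ∈ Q, (R.tileSupp n t ∩ Metric.closedBall z r).Nonempty) →
      Q.Finite ∧ Q.ncard ≤ N := by
  obtain ⟨ρ, hρ, c, hc⟩ := R.exists_ball_subset_supp n
  obtain ⟨D, hD, hsupp⟩ := R.exists_supp_subset_closedBall n
  obtain ⟨F, hF, hcov⟩ := Metric.totallyBounded_iff.1
    (isCompact_closedBall (0 : Space d) (r + D + D)).totallyBounded (ρ / 2) (half_pos hρ)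
  refine ⟨F.ncard, fun Q z hQ hmeet => ?_⟩
  have hloc : ∀ t ∈ Q, ∃ f ∈ F, t.2 + c t.1 - z ∈ Metric.ball f (ρ / 2) := by
    intro t ht
    obtain ⟨p, hp, hpz⟩ := hmeet t ht
    have h1 := hsupp _ ((R.mem_tileSupp).1 hp)
    have h2 := hsupp _ (hc t.1 (Metric.mem_ball_self hρ))
    rw [mem_closedBall_zero_iff] at h1 h2
    rw [mem_closedBall_iff_norm] at hpz
    have h3 : t.2 + c t.1 - z ∈ Metric.closedBall (0 : Space d) (r + D + D) := by
      rw [mem_closedBall_zero_iff]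
      have : t.2 + c t.1 - z = (p - z) - (p - t.2) + c t.1 := by abel
      rw [this]
      exact (norm_add_le _ _).trans (add_le_add ((norm_sub_le _ _).trans (add_le_add hpz h1)) h2)
    simpa only [mem_iUnion, exists_prop] using hcov h3
  choose! f hf hball using hloc
  have hinj : InjOn f Q := by
    intro s hs t ht hst
    have h1 := hball s hs
    have h2 := hball t ht
    rw [hst] at h1
    have h3 : dist (s.2 + c s.1) (t.2 + c t.1) < ρ := by
      have := dist_triangle_right (s.2 + c s.1 - z) (t.2 + c t.1 - z) (f t)
      rw [dist_sub_right] at this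
      rw [Metric.mem_ball] at h1 h2
      linarith
    refine R.eq_of_mem_interior_tileSupp hQ hs ht (x := s.2 + c s.1) ?_ ?_
    · rw [mem_tileSupp, add_sub_cancel_left]
      exact hc _ (Metric.mem_ball_self hρ)
    · refine interior_maximal (s := R.tileSupp n t) (t := Metric.ball (t.2 + c t.1) ρ) ?_
        Metric.isOpen_ball h3
      intro y hy
      rw [mem_tileSupp]
      refine hc _ ?_
      rw [Metric.mem_ball, dist_eq_norm] at hy ⊢
      rwa [sub_sub]
  exact ⟨Finite.of_injOn (fun t ht => hf t ht) hinj hF,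
    ncard_le_ncard_of_injOn f (fun t ht => hf t ht) hinj hF⟩

/-- The tiles of `T` that meet the closed ball of radius `r` about `z`. -/
def tilesMeeting (n : ℕ) (T : Set (R.Tile n)) (z : Space d) (r : ℝ) : Set (R.Tile n) :=
  {t ∈ T | (R.tileSupp n t ∩ Metric.closedBall z r).Nonempty}

theorem IsTiling.closedBall_subset_support {n : ℕ} {T : Set (R.Tile n)} (hT : R.IsTiling n T)
    (z : Space d) (r : ℝ) :
    Metric.closedBall z r ⊆ R.support n (R.tilesMeeting n T z r) := by
  intro y hy
  obtain ⟨t, ht, hyt⟩ := (R.mem_support).1 (hT.covers.symm ▸ mem_univ y)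
  exact (R.mem_support).2 ⟨t, ⟨ht, y, hyt, hy⟩, hyt⟩

theorem IsTiling.isPatch_tilesMeeting {n : ℕ} {T : Set (R.Tile n)} (hT : R.IsTiling n T)
    (z : Space d) {r : ℝ} (hr : 0 ≤ r) : R.IsPatch n (R.tilesMeeting n T z r) where
  finite := by
    obtain ⟨N, hN⟩ := R.exists_card_bound n r
    exact (hN _ z (hT.nonOverlapping.mono fun t ht => ht.1) fun t ht => ht.2).1
  nonOverlapping := hT.nonOverlapping.mono fun t ht => ht.1
  connected := by
    have hsub := hT.closedBall_subset_support R z r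
    refine ⟨⟨z, hsub (Metric.mem_closedBall_self hr)⟩,
      isPreconnected_of_forall z fun y hy => ?_⟩
    obtain ⟨t, ht, hyt⟩ := (R.mem_support).1 hy
    refine ⟨Metric.closedBall z r ∪ R.tileSupp n t, union_subset hsub fun x hx =>
      (R.mem_support).2 ⟨t, ht, hx⟩, Or.inl (Metric.mem_closedBall_self hr), Or.inr hyt, ?_⟩
    refine IsPreconnected.union' ?_ (convex_closedBall z r).isPreconnected
      (R.isConnected_tileSupp n t).isPreconnected
    rw [inter_comm]
    exact ht.2

theorem IsTiling.nonempty {n : ℕ} {T : Set (R.Tile n)} (hT : R.IsTiling n T) : T.Nonempty := by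
  obtain ⟨t, ht, -⟩ := (R.mem_support).1 (hT.covers.symm ▸ mem_univ (0 : Space d))
  exact ⟨t, ht⟩

/-- Any two tiles of a tiling belong to a common patch, so in a fusion tiling they occur, in the
same relative position, inside one supertile. -/
theorem IsFusionTiling.exists_constituents {n : ℕ} {T : Set (R.Tile n)}
    (hT : R.IsFusionTiling n T) {s t : R.Tile n} (hs : s ∈ T) (ht : t ∈ T) :
    ∃ (m : ℕ) (j : Fin (R.num (n + m))) (v : Space d),
      (s.1, s.2 + v) ∈ R.constituents n m j ∧ (t.1, t.2 + v) ∈ R.constituents n m j := by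
  obtain ⟨x, hx⟩ := (R.isConnected_tileSupp n s).nonempty
  obtain ⟨y, hy⟩ := (R.isConnected_tileSupp n t).nonempty
  obtain ⟨m, j, v, h⟩ := hT.admitted (R.tilesMeeting n T x (dist y x)) (fun _ h => h.1)
    (hT.isTiling.isPatch_tilesMeeting R x dist_nonneg)
  exact ⟨m, j, v, h ⟨s, ⟨hs, x, hx, Metric.mem_closedBall_self dist_nonneg⟩, rfl⟩,
    h ⟨t, ⟨ht, y, hy, Metric.mem_closedBall.2 le_rfl⟩, rfl⟩⟩

/-! ### The hierarchy of supertilings of a fusion tiling -/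

theorem subdivide_translate (n : ℕ) (v : Space d) (T : Set (R.Tile (n + 1))) :
    R.subdivide n (R.translate (n + 1) v T) = R.translate n v (R.subdivide n T) := by
  ext t
  rw [mem_translate, mem_subdivide, mem_subdivide]
  constructor
  · rintro ⟨s, hs, h⟩
    refine ⟨_, (R.mem_translate).1 hs, ?_⟩
    rwa [sub_sub_sub_cancel_right]
  · rintro ⟨s, hs, h⟩
    refine ⟨(s.1, s.2 + v), ⟨s, hs, rfl⟩, ?_⟩
    simpa only [sub_sub, add_comm] using h

variable {R}

/-- The homeomorphism from `X^n` to `X^0` obtained by iterating the subdivision maps. -/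
def toBase (hrec : R.Recognizable) : ∀ n, R.TilingSpace n ≃ₜ R.TilingSpace 0
  | 0 => Homeomorph.refl _
  | n + 1 => (hrec n).choose.trans (toBase hrec n)

/-- The tiling by `n`-supertiles from which `T` is obtained by subdivision. -/
def level (hrec : R.Recognizable) (n : ℕ) (T : R.TilingSpace 0) : R.TilingSpace n :=
  (toBase hrec n).symm T

theorem level_zero (hrec : R.Recognizable) (T : R.TilingSpace 0) : level hrec 0 T = T := rfl

theorem subdivide_level (hrec : R.Recognizable) (n : ℕ) (T : R.TilingSpace 0) :
    R.subdivide n (level hrec (n + 1) T).1 = (level hrec n T).1 := by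
  rw [← (hrec n).choose_spec]
  exact congrArg Subtype.val ((hrec n).choose.apply_symm_apply _)

theorem level_shift (hrec : R.Recognizable) (v : Space d) (T : R.TilingSpace 0) :
    ∀ n, level hrec n (R.shift v T) = R.shift v (level hrec n T)
  | 0 => rfl
  | n + 1 => by
    apply (hrec n).choose.injective
    apply Subtype.ext
    rw [(hrec n).choose_spec, (hrec n).choose_spec, subdivide_level, level_shift hrec v T n]
    refine Eq.trans ?_ (R.subdivide_translate n v _).symm
    rw [subdivide_level]
    rfl

theorem mem_level_of_mem_parts (hrec : R.Recognizable) {T : R.TilingSpace 0} {n : ℕ}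
    {j : Fin (R.num (n + 1))} {w : Space d} (h : (j, w) ∈ (level hrec (n + 1) T).1)
    {i : Fin (R.num n)} {v : Space d} (hv : (i, v) ∈ R.parts n j) :
    (i, w + v) ∈ (level hrec n T).1 := by
  rw [← subdivide_level, mem_subdivide]
  exact ⟨_, h, by simpa using hv⟩

theorem mem_level_of_mem_constituents (hrec : R.Recognizable) {T : R.TilingSpace 0} {n : ℕ} :
    ∀ {m : ℕ} {j : Fin (R.num (n + m))} {w : Space d}, (j, w) ∈ (level hrec (n + m) T).1 →
      ∀ {i : Fin (R.num n)} {v : Space d}, (i, v) ∈ R.constituents n m j →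
        (i, w + v) ∈ (level hrec n T).1
  | 0, j, w, h, i, v, hv => by
    have hv' := (R.mem_constituents_zero).1 hv
    rw [Prod.mk.injEq] at hv'
    rw [hv'.1, hv'.2, add_zero]
    exact h
  | m + 1, j, w, h, i, v, hv => by
    obtain ⟨p, hp, hv⟩ := (R.mem_constituents_succ).1 hv
    have := mem_level_of_mem_constituents hrec (mem_level_of_mem_parts hrec h hp) hv
    simpa [add_assoc] using this

/-- Every supertile of positive level occurs in every fusion tiling. -/
theorem exists_mem_level (hrec : R.Recognizable) (hprim : R.StronglyPrimitive)
    (T : R.TilingSpace 0) {n : ℕ} (hn : 1 ≤ n) (i : Fin (R.num n)) :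
    ∃ w, (i, w) ∈ (level hrec n T).1 := by
  obtain ⟨⟨j, w⟩, h⟩ := (level hrec (n + 1) T).2.isTiling.nonempty
  obtain ⟨v, hv⟩ := hprim n hn j i
  exact ⟨_, mem_level_of_mem_parts hrec h hv⟩

/-! ### Phases -/

/-- The phase `exp(2πi α·v)` by which an eigenfunction with eigenvalue `α` changes under
translation by `-v`. -/
def phase (α v : Space d) : ℂ := Complex.exp (2 * Real.pi * Complex.I * (inner ℝ α v : ℝ))

/-- The distance of the phase of `v` from `1`. -/
def defect (α v : Space d) : ℝ := ‖phase α v - 1‖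

theorem phase_eq (α v : Space d) : phase α v = (Circle.exp (2 * Real.pi * inner ℝ α v) : ℂ) := by
  rw [phase, Circle.coe_exp]
  congr 1
  push_cast
  ring

theorem norm_phase (α v : Space d) : ‖phase α v‖ = 1 := by
  rw [phase_eq, Circle.norm_coe]

theorem phase_add (α v w : Space d) : phase α (v + w) = phase α v * phase α w := by
  rw [phase, phase, phase, ← Complex.exp_add, inner_add_right]
  congr 1
  push_cast
  ring

theorem phase_zero (α : Space d) : phase α 0 = 1 := by simp [phase]

theorem norm_phase_sub (α v w : Space d) : ‖phase α v - phase α w‖ = defect α (v - w) := by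
  have h : phase α v - phase α w = (phase α (v - w) - 1) * phase α w := by
    rw [sub_mul, ← phase_add, sub_add_cancel, one_mul]
  rw [h, norm_mul, norm_phase, mul_one, defect]

theorem defect_sub_comm (α v w : Space d) : defect α (v - w) = defect α (w - v) := by
  rw [← norm_phase_sub, norm_sub_rev, norm_phase_sub]

theorem defect_neg (α v : Space d) : defect α (-v) = defect α v := by
  rw [← zero_sub, defect_sub_comm, sub_zero]

theorem defect_add_le (α v w : Space d) : defect α (v + w) ≤ defect α v + defect α w := by
  have h : phase α (v + w) - 1 = (phase α v - 1) * phase α w + (phase α w - 1) := by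
    rw [phase_add]
    ring
  calc defect α (v + w) ≤ ‖(phase α v - 1) * phase α w‖ + ‖phase α w - 1‖ := by
        rw [defect, h]
        exact norm_add_le _ _
    _ = defect α v + defect α w := by rw [norm_mul, norm_phase, mul_one, defect, defect]

theorem continuous_phase (α : Space d) : Continuous (phase α) := by
  unfold phase
  fun_prop

theorem eta_nonneg (n : ℕ) (α : Space d) : 0 ≤ R.eta n α := by
  apply Real.sSup_nonneg
  rintro _ ⟨v, -, rfl⟩
  exact norm_nonneg _

theorem defect_le_eta {n : ℕ} {α v : Space d} (hv : v ∈ R.returnVectors n) :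
    defect α v ≤ R.eta n α :=
  le_csSup ((R.returnVectors_finite n).image _).bddAbove ⟨v, hv, rfl⟩

theorem returnVectors_nonempty (n : ℕ) : (R.returnVectors n).Nonempty := by
  let j : Fin (R.num (n + 2)) := ⟨0, R.num_pos _⟩
  obtain ⟨p, hp⟩ := R.parts_nonempty (n + 1) j
  obtain ⟨q, hq⟩ := R.parts_nonempty n p.1
  have h : (q.1, q.2 + p.2) ∈ R.constituents n 2 j :=
    (R.mem_constituents_succ).2 ⟨p, hp, (R.mem_constituents_one).2 (by simpa using hq)⟩
  exact ⟨_, j, q.1, _, _, h, h, rfl⟩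

theorem exists_defect_eq_eta (n : ℕ) (α : Space d) :
    ∃ v ∈ R.returnVectors n, defect α v = R.eta n α :=
  ((R.returnVectors_nonempty n).image _).csSup_mem ((R.returnVectors_finite n).image _)

/-! ### From summability to an eigenfunction -/

/-- A distinguished type of `n`-supertile. -/
def baseType (R : FusionRule d) (n : ℕ) : Fin (R.num n) := ⟨0, R.num_pos n⟩

/-- Strong primitivity places an `n`-supertile of the distinguished type inside the
`(n+1)`-supertile of the distinguished type. It says nothing about `n = 0`, so the offset of
level `0` is arbitrary. -/
theorem exists_baseOffset (hprim : R.StronglyPrimitive) (n : ℕ) :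
    ∃ v : Space d, 1 ≤ n → (R.baseType n, v) ∈ R.parts n (R.baseType (n + 1)) := by
  by_cases hn : 1 ≤ n
  · obtain ⟨v, hv⟩ := hprim n hn (R.baseType (n + 1)) (R.baseType n)
    exact ⟨v, fun _ => hv⟩
  · exact ⟨0, fun h => absurd h hn⟩

/-- The position of a chosen `n`-supertile of the distinguished type inside the
`(n+1)`-supertile of the distinguished type. -/
def baseOffset (hprim : R.StronglyPrimitive) (n : ℕ) : Space d :=
  (exists_baseOffset hprim n).choose

theorem baseOffset_mem (hprim : R.StronglyPrimitive) {n : ℕ} (hn : 1 ≤ n) :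
    (R.baseType n, baseOffset hprim n) ∈ R.parts n (R.baseType (n + 1)) :=
  (exists_baseOffset hprim n).choose_spec hn

/-- The accumulated offsets of the levels below `n`. -/
def baseSum (hprim : R.StronglyPrimitive) (n : ℕ) : Space d :=
  ∑ k ∈ Finset.range n, baseOffset hprim k

theorem baseSum_succ (hprim : R.StronglyPrimitive) (n : ℕ) :
    baseSum hprim (n + 1) = baseSum hprim n + baseOffset hprim n :=
  Finset.sum_range_succ _ _

theorem mem_returnVectors_of_mem_parts (hprim : R.StronglyPrimitive) {n : ℕ}
    {j : Fin (R.num (n + 1))} {i : Fin (R.num n)} {x y : Space d}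
    (hx : (i, x) ∈ R.parts n j) (hy : (i, y) ∈ R.parts n j) : y - x ∈ R.returnVectors n := by
  obtain ⟨v, hv⟩ := hprim (n + 1) (Nat.le_add_left 1 n) (R.baseType (n + 2)) j
  refine ⟨R.baseType (n + 2), i, x + v, y + v, ?_, ?_, (add_sub_add_right_eq_sub y x v).symm⟩
  · exact (R.mem_constituents_succ).2 ⟨_, hv, (R.mem_constituents_one).2 (by simpa using hx)⟩
  · exact (R.mem_constituents_succ).2 ⟨_, hv, (R.mem_constituents_one).2 (by simpa using hy)⟩

/-- Climbing the hierarchy: inside one `(n+m+1)`-supertile, the phase of an `n`-supertile of the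
distinguished type is compared with that of an `(n+m)`-supertile of the distinguished type, and
each level passed costs one `eta`. -/
theorem defect_climb_le (hprim : R.StronglyPrimitive) (α : Space d) {n : ℕ} (hn : 1 ≤ n) :
    ∀ (m : ℕ) (j : Fin (R.num (n + m + 1))) (x w : Space d),
      (R.baseType n, x) ∈ R.constituents n (m + 1) j →
      (R.baseType (n + m), w) ∈ R.parts (n + m) j →
      defect α ((x + baseSum hprim n) - (w + baseSum hprim (n + m))) ≤
        R.eta n α + ∑ k ∈ Finset.range m, R.eta (n + k) α
  | 0, j, x, w, hx, hw => by
    have hx' := (R.mem_constituents_one).1 hx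
    rw [Finset.sum_range_zero, add_zero, add_zero, add_sub_add_right_eq_sub]
    exact defect_le_eta (mem_returnVectors_of_mem_parts hprim hw hx')
  | m + 1, j, x, w, hx, hw => by
    obtain ⟨p, hp, hx⟩ := (R.mem_constituents_succ).1 hx
    obtain ⟨w', hw'⟩ := hprim (n + m) (by omega) p.1 (R.baseType (n + m))
    have h1 := defect_climb_le hprim α hn m p.1 _ w' hx hw'
    -- both `w' + p.2` and `w + baseOffset` are positions of `(n+m)`-supertiles inside `j`
    have h2 : defect α ((w' + p.2) - (w + baseOffset hprim (n + m))) ≤ R.eta (n + m) α := by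
      refine defect_le_eta ⟨j, R.baseType (n + m), w + baseOffset hprim (n + m), w' + p.2,
        ?_, ?_, rfl⟩
      · exact (R.mem_constituents_succ).2 ⟨_, hw, (R.mem_constituents_one).2
          (by simp only [add_sub_cancel_left]; exact baseOffset_mem hprim (by omega))⟩
      · exact (R.mem_constituents_succ).2 ⟨_, hp, (R.mem_constituents_one).2 (by simpa using hw')⟩
    have h3 : (x + baseSum hprim n) - (w + baseSum hprim (n + (m + 1))) =
        ((x - p.2 + baseSum hprim n) - (w' + baseSum hprim (n + m))) +
          ((w' + p.2) - (w + baseOffset hprim (n + m))) := by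
      have hb : baseSum hprim (n + (m + 1)) = _ := baseSum_succ hprim (n + m)
      simp only [hb]
      abel
    rw [h3, Finset.sum_range_succ]
    refine (defect_add_le _ _ _).trans ?_
    linarith

theorem exists_constituents_succ (hprim : R.StronglyPrimitive) {n : ℕ} (hn : 1 ≤ n) (m : ℕ)
    (j : Fin (R.num (n + m))) : ∃ (j' : Fin (R.num (n + m + 1))) (v : Space d),
      ∀ t ∈ R.constituents n m j, (t.1, t.2 + v) ∈ R.constituents n (m + 1) j' := by
  obtain ⟨v, hv⟩ := hprim (n + m) (by omega) (R.baseType (n + m + 1)) j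
  exact ⟨_, v, fun t ht => (R.mem_constituents_succ).2 ⟨_, hv, by simpa using ht⟩⟩

/-- Four times the tail `∑_{k ≥ n} eta k`. -/
def tail (R : FusionRule d) (α : Space d) (n : ℕ) : ℝ := 4 * ∑' k, R.eta (k + n) α

theorem tendsto_tail (R : FusionRule d) (α : Space d) :
    Filter.Tendsto (R.tail α) Filter.atTop (nhds 0) := by
  have := (tendsto_sum_nat_add fun k => R.eta k α).const_mul 4
  rwa [mul_zero] at this

/-- The phases of all `n`-supertiles of the distinguished type in a fusion tiling agree up to the
tail of the series. -/
theorem defect_le_tail {α : Space d}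
    (hprim : R.StronglyPrimitive) (hs : Summable fun n => R.eta n α)
    {n : ℕ} (hn : 1 ≤ n) {T : Set (R.Tile n)} (hT : R.IsFusionTiling n T) {x y : Space d}
    (hx : (R.baseType n, x) ∈ T) (hy : (R.baseType n, y) ∈ T) :
    defect α (x - y) ≤ R.tail α n := by
  obtain ⟨m, j, v, hx', hy'⟩ := hT.exists_constituents R hx hy
  obtain ⟨j', v', h⟩ := exists_constituents_succ hprim hn m j
  obtain ⟨w, hw⟩ := hprim (n + m) (by omega) j' (R.baseType (n + m))
  have h1 := defect_climb_le hprim α hn m j' _ w (h _ hx') hw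
  have h2 := defect_climb_le hprim α hn m j' _ w (h _ hy') hw
  rw [defect_sub_comm] at h2
  have hs' : Summable fun k => R.eta (k + n) α := (summable_nat_add_iff n).2 hs
  have h3 : ∑ k ∈ Finset.range m, R.eta (n + k) α ≤ ∑' k, R.eta (k + n) α := by
    simp only [add_comm n]
    exact hs'.sum_le_tsum _ fun k _ => eta_nonneg _ _
  have h4 : R.eta n α ≤ ∑' k, R.eta (k + n) α := by
    simpa using hs'.le_tsum 0 fun k _ => eta_nonneg _ _
  have h5 := defect_add_le α _ _ |>.trans (add_le_add h1 h2)
  have h6 : x - y = (x + v + v' + baseSum hprim n - (w + baseSum hprim (n + m))) +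
      (w + baseSum hprim (n + m) - (y + v + v' + baseSum hprim n)) := by abel
  rw [h6, tail]
  linarith

theorem mem_level_baseType (hrec : R.Recognizable) (hprim : R.StronglyPrimitive)
    {T : R.TilingSpace 0} {n : ℕ} (hn : 1 ≤ n) (m : ℕ) {x : Space d}
    (hx : (R.baseType (n + m), x) ∈ (level hrec (n + m) T).1) :
    (R.baseType n, x + baseSum hprim (n + m) - baseSum hprim n) ∈ (level hrec n T).1 := by
  induction m generalizing x with
  | zero => simpa using hx
  | succ m ih =>
    have := ih (mem_level_of_mem_parts hrec hx (baseOffset_mem hprim (n := n + m) (by omega)))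
    rwa [add_assoc x, add_comm (baseOffset _ _), ← baseSum_succ] at this

/-- The value of the eigenfunction, approximated by the phase of any `n`-supertile of the
distinguished type with an error of at most `tail n`. -/
theorem exists_eigenfunction_value {α : Space d}
    (hrec : R.Recognizable) (hprim : R.StronglyPrimitive)
    (hs : Summable fun n => R.eta n α) (T : R.TilingSpace 0) :
    ∃ z : Circle, ∀ n, 1 ≤ n → ∀ x, (R.baseType n, x) ∈ (level hrec n T).1 →
      ‖(z : ℂ) - phase α (-(x + baseSum hprim n))‖ ≤ R.tail α n := by
  have hex : ∀ n, ∃ x, 1 ≤ n → (R.baseType n, x) ∈ (level hrec n T).1 := fun n => by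
    by_cases hn : 1 ≤ n
    · obtain ⟨x, hx⟩ := exists_mem_level hrec hprim T hn (R.baseType n)
      exact ⟨x, fun _ => hx⟩
    · exact ⟨0, fun h => absurd h hn⟩
  choose x hx using hex
  let u : ℕ → Circle := fun n => Circle.exp (2 * Real.pi * inner ℝ α (-(x n + baseSum hprim n)))
  have hu : ∀ n, (u n : ℂ) = phase α (-(x n + baseSum hprim n)) := fun n => (phase_eq _ _).symm
  have hcmp : ∀ n, 1 ≤ n → ∀ m y, (R.baseType n, y) ∈ (level hrec n T).1 →
      ‖(u (n + m) : ℂ) - phase α (-(y + baseSum hprim n))‖ ≤ R.tail α n := by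
    intro n hn m y hy
    have h := defect_le_tail hprim hs hn (level hrec n T).2 hy
      (mem_level_baseType hrec hprim hn m (hx (n + m) (by omega)))
    rw [hu, norm_phase_sub]
    refine le_of_eq_of_le (congrArg _ ?_) h
    abel
  have hcauchy : CauchySeq u := by
    refine cauchySeq_of_le_tendsto_0' (fun n => if 1 ≤ n then R.tail α n else 2) ?_ ?_
    · intro n m hnm
      split_ifs with hn
      · obtain ⟨k, rfl⟩ := Nat.exists_eq_add_of_le hnm
        rw [dist_comm]
        have := hcmp n hn k (x n) (hx n hn)
        rwa [← hu, ← dist_eq_norm] at this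
      · refine (dist_eq_norm (u n : ℂ) (u m)).le.trans ((norm_sub_le _ _).trans ?_)
        rw [Circle.norm_coe, Circle.norm_coe]
        norm_num
    · refine (R.tendsto_tail α).congr' ?_
      filter_upwards [Filter.eventually_ge_atTop 1] with n hn
      rw [if_pos hn]
  obtain ⟨z, hz⟩ := cauchySeq_tendsto_of_complete hcauchy
  refine ⟨z, fun n hn y hy => ?_⟩
  have h1 : Filter.Tendsto (fun m => ‖(u (n + m) : ℂ) - phase α (-(y + baseSum hprim n))‖)
      Filter.atTop (nhds ‖(z : ℂ) - phase α (-(y + baseSum hprim n))‖) := by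
    have h2 := ((continuous_subtype_val.tendsto z : Filter.Tendsto (fun z : Circle => (z : ℂ)) _ _)).comp
      (hz.comp (Filter.tendsto_add_atTop_nat n))
    have h3 := (h2.sub_const (phase α (-(y + baseSum hprim n)))).norm
    refine h3.congr fun m => ?_
    rw [add_comm n m]
    rfl
  exact le_of_tendsto' h1 fun m => hcmp n hn m y hy

theorem isOpen_tilingSpace_iff {k : ℕ} {U : Set (R.TilingSpace k)} :
    IsOpen U ↔ ∀ T ∈ U, ∃ ε > 0, ∀ T' : R.TilingSpace k, R.Close k ε T.1 T'.1 → T' ∈ U :=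
  Iff.rfl

/-- Having a tile of type `i` at distance less than `ρ` from `x` is an open condition. -/
theorem isOpen_setOf_exists_mem_ball {k : ℕ} (i : Fin (R.num k)) (x : Space d) (ρ : ℝ) :
    IsOpen {S : R.TilingSpace k | ∃ y, (i, y) ∈ S.1 ∧ ‖y - x‖ < ρ} := by
  rw [isOpen_tilingSpace_iff]
  rintro S ⟨y, hy, hyx⟩
  obtain ⟨p, hp⟩ := (R.isConnected_supp k i).nonempty
  -- small enough for the displacement, and such that the ball of radius `1/ε` meets the tile
  -- even after a translation by at most `1`
  let M := ‖p + y‖ + 1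
  have hM : 0 < M := by positivity
  let ε := min (min 1 ((ρ - ‖y - x‖) / 3)) (1 / M)
  have hε : 0 < ε := lt_min (lt_min one_pos (by linarith)) (by positivity)
  have hε1 : ε ≤ 1 := (min_le_left _ _).trans (min_le_left _ _)
  have hε2 : ε ≤ (ρ - ‖y - x‖) / 3 := (min_le_left _ _).trans (min_le_right _ _)
  have hε3 : M ≤ 1 / ε := by
    rw [le_div_iff₀ hε, ← le_div_iff₀' hM]
    exact min_le_right _ _
  refine ⟨ε, hε, ?_⟩
  rintro S' ⟨g, g', hg, hg', hagree⟩
  have hmem : (i, y + g) ∈ R.translate k g' S'.1 := by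
    refine (hagree (i, y + g) ⟨p + (y + g), ?_, ?_⟩).1 ⟨(i, y), hy, rfl⟩
    · rw [mem_tileSupp, add_sub_cancel_right]
      exact hp
    · rw [mem_closedBall_zero_iff, ← add_assoc]
      exact (norm_add_le _ _).trans ((add_le_add_right (hg.trans hε1) _).trans hε3)
  rw [mem_translate] at hmem
  refine ⟨_, hmem, ?_⟩
  have h1 : y + g - g' - x = (y - x) + (g - g') := by abel
  rw [h1]
  have h2 := norm_add_le (y - x) (g - g')
  have h3 := norm_sub_le g g'
  linarith

theorem isTopologicalEigenvalue_of_summable {α : Space d}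
    (hrec : R.Recognizable) (hprim : R.StronglyPrimitive)
    (hs : Summable fun n => R.eta n α) : R.IsTopologicalEigenvalue α := by
  choose f hf using exists_eigenfunction_value hrec hprim hs
  refine ⟨f, ?_, ?_⟩
  · rw [continuous_def]
    intro V hV
    rw [isOpen_tilingSpace_iff]
    intro T hT
    obtain ⟨δ, hδ, hball⟩ := Metric.isOpen_iff.1 hV _ hT
    -- a level `n ≥ 1` at which one supertile determines the eigenfunction up to `δ / 3`
    obtain ⟨n, hn, hn1⟩ := ((R.tendsto_tail α).eventually (gt_mem_nhds (by linarith : 0 < δ / 3))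
      |>.and (Filter.eventually_ge_atTop 1)).exists
    obtain ⟨x, hx⟩ := exists_mem_level hrec hprim T hn1 (R.baseType n)
    obtain ⟨ρ, hρ, hcont⟩ := Metric.continuous_iff.1 (continuous_phase α) 0 (δ / 3) (by linarith)
    have hopen := (isOpen_setOf_exists_mem_ball (R.baseType n) x ρ).preimage
      (toBase hrec n).symm.continuous
    rw [isOpen_tilingSpace_iff] at hopen
    obtain ⟨ε, hε, h⟩ := hopen T ⟨x, hx, by simpa using hρ⟩
    refine ⟨ε, hε, fun T' hT' => hball ?_⟩
    obtain ⟨y, hy, hyx⟩ := h T' hT'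
    have h1 := hf T n hn1 x hx
    have h2 := hf T' n hn1 y hy
    have h3 : ‖phase α (-(y + baseSum hprim n)) - phase α (-(x + baseSum hprim n))‖ < δ / 3 := by
      have := hcont (y - x) (by simpa using hyx)
      rw [dist_eq_norm, norm_phase_sub, sub_zero] at this
      rw [norm_phase_sub, defect_sub_comm]
      refine lt_of_eq_of_lt (congrArg _ ?_) this
      abel
    have h4 : dist (f T') (f T) = ‖(f T' : ℂ) - f T‖ := dist_eq_norm (f T' : ℂ) (f T)
    have h5 : (f T' : ℂ) - f T = ((f T' : ℂ) - phase α (-(y + baseSum hprim n))) +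
        (phase α (-(y + baseSum hprim n)) - phase α (-(x + baseSum hprim n))) -
        ((f T : ℂ) - phase α (-(x + baseSum hprim n))) := by ring
    rw [Metric.mem_ball, h4, h5]
    refine (norm_sub_le _ _).trans_lt ((add_le_add_left (norm_add_le _ _) _).trans_lt ?_)
    linarith
  · intro T v
    -- both sides are approximated by the phases of the supertiles of `T`
    have hle : ∀ n, 1 ≤ n → ‖(f (R.shift (-v) T) : ℂ) - phase α v * f T‖ ≤
        R.tail α n + R.tail α n := by
      intro n hn
      obtain ⟨x, hx⟩ := exists_mem_level hrec hprim T hn (R.baseType n)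
      have hx' : (R.baseType n, x + -v) ∈ (level hrec n (R.shift (-v) T)).1 := by
        rw [level_shift]
        exact ⟨_, hx, rfl⟩
      have h1 := hf _ n hn _ hx'
      have h2 := hf _ n hn _ hx
      have h3 : phase α (-(x + -v + baseSum hprim n)) =
          phase α v * phase α (-(x + baseSum hprim n)) := by
        rw [← phase_add]
        congr 1
        abel
      have h4 : (f (R.shift (-v) T) : ℂ) - phase α v * f T =
          ((f (R.shift (-v) T) : ℂ) - phase α (-(x + -v + baseSum hprim n))) -
          phase α v * ((f T : ℂ) - phase α (-(x + baseSum hprim n))) := by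
        rw [h3]
        ring
      rw [h4]
      refine (norm_sub_le _ _).trans (add_le_add h1 ?_)
      rwa [norm_mul, norm_phase, one_mul]
    have hlim : Filter.Tendsto (fun n => R.tail α n + R.tail α n) Filter.atTop (nhds 0) := by
      simpa using (R.tendsto_tail α).add (R.tendsto_tail α)
    have h0 := ge_of_tendsto hlim ((Filter.eventually_ge_atTop 1).mono hle)
    exact sub_eq_zero.1 (norm_le_zero_iff.1 h0)

/-! ### Finitely many relative positions -/

/-- The types and the relative position of two touching tiles of `T`. -/
def touchSet (T : Set (R.Tile 0)) : Set (Fin (R.num 0) × Fin (R.num 0) × Space d) :=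
  {q | ∃ s ∈ T, ∃ t ∈ T, s ≠ t ∧ (R.tileSupp 0 s ∩ R.tileSupp 0 t).Nonempty ∧
    q = (s.1, t.1, t.2 - s.2)}

theorem finite_touchSet (hflc : R.FiniteLocalComplexity) (T : R.TilingSpace 0) :
    (touchSet T.1).Finite := by
  obtain ⟨F, hF, h⟩ := hflc T
  have hfin : (⋃ Q ∈ {Q ∈ F | Q.Finite}, (fun q : R.Tile 0 × R.Tile 0 =>
      (q.1.1, q.2.1, q.2.2 - q.1.2)) '' (Q ×ˢ Q)).Finite :=
    (hF.subset (sep_subset _ _)).biUnion fun Q hQ => (hQ.2.prod hQ.2).image _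
  refine hfin.subset ?_
  rintro _ ⟨s, hs, t, ht, hne, hst, rfl⟩
  have hsub : {s, t} ⊆ T.1 := insert_subset hs (singleton_subset_iff.2 ht)
  have hpatch : R.IsPatch 0 {s, t} :=
    { finite := toFinite _
      nonOverlapping := T.2.isTiling.nonOverlapping.mono hsub
      connected := by
        have : R.support 0 {s, t} = R.tileSupp 0 s ∪ R.tileSupp 0 t := by
          simp [FusionData.support]
        rw [this]
        exact IsConnected.union hst (R.isConnected_tileSupp 0 s) (R.isConnected_tileSupp 0 t) }
  obtain ⟨Q, hQF, v, hQ⟩ := h _ hsub hpatch (ncard_pair hne)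
  have hQfin : Q.Finite := by
    have h1 : R.translate 0 (-v) {s, t} = Q := by
      rw [hQ, translate_translate, add_neg_cancel, translate_zero]
    rw [← h1]
    exact (toFinite _).image _
  have hs' := (R.mem_translate).1 (hQ ▸ mem_insert s {t})
  have ht' := (R.mem_translate).1 (hQ ▸ mem_insert_of_mem s (mem_singleton t))
  refine mem_biUnion (show Q ∈ {Q ∈ F | Q.Finite} from ⟨hQF, hQfin⟩)
    ⟨((s.1, s.2 - v), (t.1, t.2 - v)), ⟨hs', ht'⟩, ?_⟩
  simp

/-- The types and the relative positions of tiles that are joined by `n` touching pairs. -/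
def chainSet (T : Set (R.Tile 0)) : ℕ → Set (Fin (R.num 0) × Fin (R.num 0) × Space d)
  | 0 => range fun i => (i, i, 0)
  | n + 1 => image2 (fun p q => (p.1, q.2.1, p.2.2 + q.2.2)) (touchSet T) (chainSet T n)

theorem finite_chainSet {T : Set (R.Tile 0)} (hT : (touchSet T).Finite) :
    ∀ n, (chainSet T n).Finite
  | 0 => finite_range _
  | n + 1 => hT.image2 _ (finite_chainSet hT n)

/-- The graph on a collection of tiles in which tiles are adjacent when they touch. -/
def touchGraph (Q : Set (R.Tile 0)) : SimpleGraph Q where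
  Adj s t := s ≠ t ∧ (R.tileSupp 0 s.1 ∩ R.tileSupp 0 t.1).Nonempty
  symm := ⟨fun s t h => ⟨h.1.symm, by rw [inter_comm]; exact h.2⟩⟩
  loopless := ⟨fun _ h => h.1 rfl⟩

theorem mem_chainSet_of_walk {T Q : Set (R.Tile 0)} (hQT : Q ⊆ T) {s t : Q}
    (w : (touchGraph Q).Walk s t) : (s.1.1, t.1.1, t.1.2 - s.1.2) ∈ chainSet T w.length := by
  induction w with
  | nil => exact ⟨_, by rw [sub_self]⟩
  | @cons a b c hab w ih =>
    refine ⟨(a.1.1, b.1.1, b.1.2 - a.1.2), ⟨a.1, hQT a.2, b.1, hQT b.2,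
      fun h => hab.1 (Subtype.ext h), hab.2, rfl⟩, _, ih, ?_⟩
    simp

/-- The tiles that meet a ball are joined to each other by touching tiles, because the ball is
connected. -/
theorem preconnected_touchGraph {T : Set (R.Tile 0)} (hT : R.IsTiling 0 T) (z : Space d) {r : ℝ}
    (hr : 0 ≤ r) : (touchGraph (R.tilesMeeting 0 T z r)).Preconnected := by
  intro s t
  by_contra hst
  have hfin := (hT.isPatch_tilesMeeting R z hr).finite
  have : Finite (R.tilesMeeting 0 T z r) := hfin
  let C : Set (R.tilesMeeting 0 T z r) := {u | (touchGraph _).Reachable s u}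
  have hclosed : ∀ A : Set (R.tilesMeeting 0 T z r),
      IsClosed (⋃ u ∈ A, R.tileSupp 0 u.1) := fun A =>
    (toFinite A).isClosed_biUnion fun u _ => (R.isCompact_tileSupp 0 u.1).isClosed
  have hmeet : ∀ (A : Set (R.tilesMeeting 0 T z r)) (u), u ∈ A →
      (Metric.closedBall z r ∩ ⋃ u ∈ A, R.tileSupp 0 u.1).Nonempty := by
    intro A u hu
    obtain ⟨x, hx, hxz⟩ := u.2.2
    exact ⟨x, hxz, mem_biUnion hu hx⟩
  have hcov : Metric.closedBall z r ⊆
      (⋃ u ∈ C, R.tileSupp 0 u.1) ∪ ⋃ u ∈ Cᶜ, R.tileSupp 0 u.1 := by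
    intro x hx
    obtain ⟨u, hu, hxu⟩ := (R.mem_support).1 (hT.closedBall_subset_support R z r hx)
    by_cases huC : (⟨u, hu⟩ : R.tilesMeeting 0 T z r) ∈ C
    · exact Or.inl (mem_biUnion huC hxu)
    · exact Or.inr (mem_biUnion huC hxu)
  obtain ⟨x, -, hx1, hx2⟩ := isPreconnected_closed_iff.1 (convex_closedBall z r).isPreconnected
    _ _ (hclosed C) (hclosed Cᶜ) hcov (hmeet C s (SimpleGraph.Reachable.refl s))
    (hmeet Cᶜ t hst)
  simp only [mem_iUnion, exists_prop] at hx1 hx2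
  obtain ⟨u, hu, hxu⟩ := hx1
  obtain ⟨u', hu', hxu'⟩ := hx2
  have hadj : (touchGraph _).Adj u u' := ⟨fun h => hu' (h ▸ hu), x, hxu, hxu'⟩
  exact hu' (SimpleGraph.Reachable.trans hu hadj.reachable)

/-- Finite local complexity in its usual form: tiles of `T` at bounded distance from each other
have finitely many relative positions. They are joined by a chain of touching tiles whose length
is bounded by the number of tiles that meet a ball. -/
theorem exists_finite_relativePositions (hflc : R.FiniteLocalComplexity) (T : R.TilingSpace 0)
    {r : ℝ} (hr : 0 ≤ r) : ∃ E : Set (Fin (R.num 0) × Fin (R.num 0) × Space d), E.Finite ∧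
      ∀ z, ∀ s ∈ R.tilesMeeting 0 T.1 z r, ∀ t ∈ R.tilesMeeting 0 T.1 z r,
        (s.1, t.1, t.2 - s.2) ∈ E := by
  classical
  obtain ⟨N, hN⟩ := R.exists_card_bound 0 r
  refine ⟨⋃ n ∈ Finset.range N, chainSet T.1 n, (Finset.range N).finite_toSet.biUnion fun n _ =>
    finite_chainSet (finite_touchSet hflc T) n, fun z s hs t ht => ?_⟩
  obtain ⟨hfin, hcard⟩ := hN (R.tilesMeeting 0 T.1 z r) z
    (T.2.isTiling.nonOverlapping.mono fun t ht => ht.1) fun t ht => ht.2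
  have := hfin.fintype
  obtain ⟨w, hw⟩ := (preconnected_touchGraph T.2.isTiling z hr ⟨s, hs⟩ ⟨t, ht⟩).exists_isPath
  have hlen := hw.length_lt
  rw [← Nat.card_eq_fintype_card, Nat.card_coe_set_eq] at hlen
  exact mem_biUnion (Finset.mem_range.2 (hlen.trans_le hcard))
    (mem_chainSet_of_walk (fun t ht => ht.1) w)

/-! ### Compactness of the orbit closure -/

/-- The translates of a fusion tiling with finite local complexity have limits along ultrafilters.
Normalising the translates so that a tile sits at the origin leaves finitely many local patterns,
so that the limit of the normalised tilings consists of the tiles that are eventually present; the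
normalising vectors are bounded and converge as well. -/
theorem exists_limit_translates (hflc : R.FiniteLocalComplexity) (T : R.TilingSpace 0)
    {ι : Type*} (𝒰 : Ultrafilter ι) (z : ι → Space d) :
    ∃ S : R.TilingSpace 0, ∀ ε > 0, ∀ r : ℝ, ∀ᶠ k in (𝒰 : Filter ι), ∃ g : Space d, ‖g‖ ≤ ε ∧
      R.AgreeOn 0 (Metric.closedBall 0 r) S.1 (R.translate 0 g (R.translate 0 (-z k) T.1)) := by
  obtain ⟨D, hD, hsupp⟩ := R.exists_supp_subset_closedBall 0
  have hcov : ∀ k, ∃ t ∈ T.1, z k ∈ R.tileSupp 0 t := fun k =>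
    (R.mem_support).1 (T.2.isTiling.covers.symm ▸ mem_univ (z k))
  choose t ht hzt using hcov
  obtain ⟨w, -, hw⟩ := (isCompact_closedBall (0 : Space d) D).ultrafilter_le_nhds
    (𝒰.map fun k => z k - (t k).2) (by
      rw [Filter.le_principal_iff]
      exact Filter.Eventually.of_forall (f := (𝒰 : Filter ι)) fun k =>
        hsupp _ ((R.mem_tileSupp).1 (hzt k)))
  let S' : ι → Set (R.Tile 0) := fun k => R.translate 0 (-(t k).2) T.1
  have hS' : ∀ k, R.IsFusionTiling 0 (S' k) := fun k => R.isFusionTiling_translate 0 _ T.2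
  let S : Set (R.Tile 0) := {s | ∀ᶠ k in (𝒰 : Filter ι), s ∈ S' k}
  have hagree : ∀ r : ℝ, ∀ᶠ k in (𝒰 : Filter ι),
      R.AgreeOn 0 (Metric.closedBall 0 r) S (S' k) := by
    intro r
    obtain ⟨E, hE, hrel⟩ := exists_finite_relativePositions hflc T
      (le_max_of_le_right hD.le : 0 ≤ max r D)
    have hmem : ∀ k, ∀ s ∈ S' k, (R.tileSupp 0 s ∩ Metric.closedBall 0 r).Nonempty →
        s ∈ (fun q => q.2) '' E := by
      rintro k s hs ⟨x, hxs, hxr⟩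
      have hs' := (R.mem_translate).1 hs
      refine ⟨_, hrel (t k).2 (t k) ⟨ht k, z k, hzt k, ?_⟩ _ ⟨hs', x + (t k).2, ?_, ?_⟩, ?_⟩
      · refine Metric.closedBall_subset_closedBall (le_max_right r D) ?_
        rw [mem_closedBall_iff_norm, ← mem_closedBall_zero_iff]
        exact hsupp _ ((R.mem_tileSupp).1 (hzt k))
      · rw [mem_tileSupp] at hxs ⊢
        simpa only [sub_neg_eq_add, add_sub_add_right_eq_sub] using hxs
      · refine Metric.closedBall_subset_closedBall (le_max_left r D) ?_
        rw [mem_closedBall_iff_norm, add_sub_cancel_right, ← mem_closedBall_zero_iff]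
        exact hxr
      · simp
    have hev : ∀ᶠ k in (𝒰 : Filter ι), ∀ s ∈ (fun q => q.2) '' E, (s ∈ S ↔ s ∈ S' k) := by
      rw [Filter.eventually_all_finite (hE.image _)]
      intro s _
      by_cases hs : s ∈ S
      · filter_upwards [show ∀ᶠ k in (𝒰 : Filter ι), s ∈ S' k from hs] with k hk
        exact iff_of_true hs hk
      · filter_upwards [Ultrafilter.eventually_not.2 hs] with k hk
        exact iff_of_false hs hk
    filter_upwards [hev] with k hk s hsr
    by_cases hs : s ∈ (fun q : Fin (R.num 0) × Fin (R.num 0) × Space d => q.2) '' E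
    · exact hk s hs
    · refine iff_of_false (fun h => ?_) fun h => hs (hmem k s h hsr)
      obtain ⟨k', hk'⟩ := Filter.Eventually.exists (f := (𝒰 : Filter ι)) h
      exact hs (hmem k' s hk' hsr)
  have hSfusion : R.IsFusionTiling 0 S :=
    { isTiling :=
        { nonOverlapping := fun s hs s' hs' hne => by
            obtain ⟨k, hk, hk'⟩ := (Filter.Eventually.and (f := (𝒰 : Filter ι)) hs hs').exists
            exact (hS' k).isTiling.nonOverlapping hk hk' hne
          covers := by
            refine eq_univ_of_forall fun x => ?_
            obtain ⟨k, hk⟩ := (hagree ‖x‖).exists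
            obtain ⟨s, hs, hxs⟩ :=
              (R.mem_support).1 ((hS' k).isTiling.covers.symm ▸ mem_univ x)
            refine (R.mem_support).2 ⟨s, (hk s ⟨x, hxs, ?_⟩).2 hs, hxs⟩
            exact mem_closedBall_zero_iff.2 le_rfl }
      admitted := fun Q hQ hP => by
        have hev : ∀ᶠ k in (𝒰 : Filter ι), ∀ s ∈ Q, s ∈ S' k :=
          (Filter.eventually_all_finite hP.finite).2 fun s hs => hQ hs
        obtain ⟨k, hk⟩ := hev.exists
        exact (hS' k).admitted Q hk hP }
  refine ⟨R.shift (-w) ⟨S, hSfusion⟩, fun ε hε r => ?_⟩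
  have hnear : ∀ᶠ k in (𝒰 : Filter ι), z k - (t k).2 ∈ Metric.closedBall w ε :=
    hw (Metric.closedBall_mem_nhds w hε)
  filter_upwards [hagree (r + ‖w‖), hnear] with k hk hkw
  refine ⟨z k - (t k).2 - w, mem_closedBall_iff_norm.1 hkw, ?_⟩
  rintro s ⟨x, hxs, hxr⟩
  have h := hk (s.1, s.2 + w) ⟨x + w, ?_, ?_⟩
  · rw [show (R.shift (-w) ⟨S, hSfusion⟩).1 = R.translate 0 (-w) S from rfl, mem_translate,
      sub_neg_eq_add, h]
    simp only [S', mem_translate]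
    have : s.2 + w - -(t k).2 = s.2 - (z k - (t k).2 - w) - -z k := by abel
    rw [this]
  · rw [mem_tileSupp] at hxs ⊢
    simpa only [add_sub_add_right_eq_sub] using hxs
  · rw [mem_closedBall_zero_iff] at hxr ⊢
    exact (norm_add_le _ _).trans (add_le_add_left hxr _)

/-! ### Large supertiles determine large balls -/

/-- The tiles that make up an `n`-supertile. -/
def pieces (R : FusionRule d) : ∀ n, Fin (R.num n) → Set (R.Tile 0)
  | 0, i => {(i, 0)}
  | n + 1, j => ⋃ p ∈ R.parts n j, R.translate 0 p.2 (pieces R n p.1)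

theorem support_pieces : ∀ (n : ℕ) (i : Fin (R.num n)), R.support 0 (R.pieces n i) = R.supp n i
  | 0, i => by simp [pieces, FusionData.support, FusionData.tileSupp]
  | n + 1, j => by
    ext x
    rw [mem_supp_succ, mem_support]
    simp only [pieces, mem_iUnion, exists_prop, FusionData.tileSupp, ← support_pieces n,
      ← support_translate, mem_support]
    constructor
    · rintro ⟨s, ⟨p, hp, hs⟩, hx⟩
      exact ⟨p, hp, s, hs, hx⟩
    · rintro ⟨p, hp, s, hs, hx⟩
      exact ⟨s, ⟨p, hp, hs⟩, hx⟩

theorem translate_pieces_subset (hrec : R.Recognizable) {T : R.TilingSpace 0} :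
    ∀ {n : ℕ} {i : Fin (R.num n)} {x : Space d}, (i, x) ∈ (level hrec n T).1 →
      R.translate 0 x (R.pieces n i) ⊆ T.1
  | 0, i, x, h => by
    rintro _ ⟨s, rfl, rfl⟩
    simpa [level_zero] using h
  | n + 1, j, x, h => by
    intro s hs
    rw [mem_translate] at hs
    simp only [pieces, mem_iUnion, exists_prop] at hs
    obtain ⟨p, hp, hs⟩ := hs
    refine translate_pieces_subset hrec (mem_level_of_mem_parts hrec h hp) ?_
    rw [mem_translate] at hs ⊢
    rwa [← sub_sub]

/-- A tile that meets the interior of a supertile of the tiling is one of its pieces. -/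
theorem mem_pieces_of_mem_interior (hrec : R.Recognizable) {T : R.TilingSpace 0}
    {n : ℕ} {i : Fin (R.num n)} {x : Space d} (h : (i, x) ∈ (level hrec n T).1)
    {t : R.Tile 0} (ht : t ∈ T.1) {p : Space d} (hpt : p ∈ R.tileSupp 0 t)
    (hp : p ∈ interior (R.tileSupp n (i, x))) : t ∈ R.translate 0 x (R.pieces n i) := by
  rw [← closure_interior_tileSupp, mem_closure_iff] at hpt
  obtain ⟨q, hq, hqt⟩ := hpt _ isOpen_interior hp
  have hq' := interior_subset hq
  rw [FusionData.tileSupp, ← support_pieces, ← support_translate, mem_support] at hq'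
  obtain ⟨s, hs, hqs⟩ := hq'
  rwa [← R.eq_of_mem_interior_tileSupp T.2.isTiling.nonOverlapping
    (translate_pieces_subset hrec h hs) ht hqs hqt]

theorem agreeOn_of_mem_level (hrec : R.Recognizable) {T : R.TilingSpace 0} {n : ℕ}
    {i : Fin (R.num n)} {x y u : Space d} (hx : (i, x) ∈ (level hrec n T).1)
    (hy : (i, y) ∈ (level hrec n T).1) {r ρ : ℝ} (hr : r < ρ)
    (hu : Metric.ball u ρ ⊆ R.supp n i) :
    R.AgreeOn 0 (Metric.closedBall 0 r) (R.translate 0 (-(x + u)) T.1)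
      (R.translate 0 (-(y + u)) T.1) := by
  have key : ∀ {x y : Space d}, (i, x) ∈ (level hrec n T).1 → (i, y) ∈ (level hrec n T).1 →
      ∀ t, (R.tileSupp 0 t ∩ Metric.closedBall 0 r).Nonempty →
        t ∈ R.translate 0 (-(x + u)) T.1 → t ∈ R.translate 0 (-(y + u)) T.1 := by
    rintro x y hx hy t ⟨p, hpt, hpr⟩ ht
    rw [mem_translate, sub_neg_eq_add] at ht ⊢
    have hmem : (t.1, t.2 + (x + u)) ∈ R.translate 0 x (R.pieces n i) := by
      refine mem_pieces_of_mem_interior hrec hx ht (p := p + (x + u)) ?_ ?_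
      · rw [mem_tileSupp] at hpt ⊢
        simpa only [add_sub_add_right_eq_sub] using hpt
      · refine interior_maximal (t := Metric.ball (x + u) ρ) ?_ Metric.isOpen_ball ?_
        · intro q hq
          rw [mem_tileSupp]
          refine hu ?_
          rw [mem_ball_iff_norm] at hq ⊢
          rwa [sub_sub]
        · rw [mem_ball_iff_norm, add_sub_cancel_right]
          exact (mem_closedBall_zero_iff.1 hpr).trans_lt hr
    refine translate_pieces_subset hrec hy ?_
    rw [mem_translate] at hmem ⊢
    have h1 : t.2 + (y + u) - y = t.2 + (x + u) - x := by abel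
    simpa only [h1] using hmem
  exact fun t ht => ⟨key hx hy t ht, key hy hx t ht⟩

/-- Van Hove supertiles contain large balls. -/
theorem VanHove.exists_ball_subset (hvH : R.VanHove) {r : ℝ} (hr : 0 < r) :
    ∃ n₀, ∀ n ≥ n₀, ∀ i : Fin (R.num n), ∃ u, Metric.ball u r ⊆ R.supp n i := by
  obtain ⟨n₀, h⟩ := hvH 1 one_pos r hr
  refine ⟨n₀, fun n hn i => ?_⟩
  have hlt := h n hn i
  rw [ENNReal.ofReal_one, one_mul] at hlt
  -- by volume, some point of the supertile is further than `r` from the boundary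
  obtain ⟨u, hu, hur⟩ : ∃ u ∈ R.supp n i, u ∉ Metric.cthickening r (frontier (R.supp n i)) := by
    by_contra! hsub
    exact absurd (MeasureTheory.measure_mono hsub) (not_le.2 hlt)
  have hfr : ∀ y ∈ Metric.ball u r, y ∉ frontier (R.supp n i) := fun y hy hyf =>
    hur (Metric.mem_cthickening_of_dist_le u y r _ hyf (Metric.mem_ball'.1 hy).le)
  have hint : ∀ y ∈ R.supp n i, y ∉ frontier (R.supp n i) → y ∈ interior (R.supp n i) :=
    fun y hy hyf => by_contra fun hyi => hyf ⟨subset_closure hy, hyi⟩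
  refine ⟨u, Subset.trans ?_ interior_subset⟩
  refine (convex_ball u r).isPreconnected.subset_left_of_subset_union isOpen_interior
    (R.isCompact_supp n i).isClosed.isOpen_compl
    (disjoint_compl_right.mono_left interior_subset) ?_
    ⟨u, Metric.mem_ball_self hr, hint u hu (hfr u (Metric.mem_ball_self hr))⟩
  intro y hy
  by_cases hyA : y ∈ R.supp n i
  · exact Or.inl (hint y hyA (hfr y hy))
  · exact Or.inr hyA

/-- If `α` is an eigenvalue, then the relative position of two supertiles of the same type and of
high level has a phase close to `1`, whatever their distance: seen from deep inside these
supertiles the tiling looks the same on a large ball, and the eigenfunction is continuous at a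
limit of these views. -/
theorem IsTopologicalEigenvalue.exists_defect_le_one (hrec : R.Recognizable) (hvH : R.VanHove)
    (hflc : R.FiniteLocalComplexity) {α : Space d} (hα : R.IsTopologicalEigenvalue α)
    (T : R.TilingSpace 0) : ∃ n₀, ∀ n ≥ n₀, ∀ (i : Fin (R.num n)) (x y : Space d),
      (i, x) ∈ (level hrec n T).1 → (i, y) ∈ (level hrec n T).1 → defect α (x - y) ≤ 1 := by
  obtain ⟨f, hf, hfα⟩ := hα
  by_contra! hcon
  have hbad : ∀ k : ℕ, ∃ (n : ℕ) (i : Fin (R.num n)) (x y u : Space d),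
      (i, x) ∈ (level hrec n T).1 ∧ (i, y) ∈ (level hrec n T).1 ∧ 1 < defect α (x - y) ∧
        Metric.ball u (k + 1) ⊆ R.supp n i := by
    intro k
    obtain ⟨n₀, h⟩ := hvH.exists_ball_subset (by positivity : (0 : ℝ) < k + 1)
    obtain ⟨n, hn, i, x, y, hx, hy, hxy⟩ := hcon n₀
    obtain ⟨u, hu⟩ := h n hn i
    exact ⟨n, i, x, y, u, hx, hy, hxy, hu⟩
  choose n i x y u hx hy hxy hu using hbad
  obtain ⟨S, hS⟩ := exists_limit_translates hflc T (Filter.hyperfilter ℕ) fun k => x k + u k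
  have hopen := Metric.isOpen_ball (x := f S) (ε := 1 / 2) |>.preimage hf
  rw [isOpen_tilingSpace_iff] at hopen
  obtain ⟨ε, hε, hclose⟩ := hopen S (Metric.mem_ball_self (by norm_num))
  have hlarge : ∀ᶠ k : ℕ in (Filter.hyperfilter ℕ : Filter ℕ), 1 / ε + ε < (k : ℝ) + 1 := by
    refine Filter.Eventually.filter_mono Nat.hyperfilter_le_atTop ?_
    filter_upwards [Filter.eventually_ge_atTop ⌈1 / ε + ε⌉₊] with k hk
    exact lt_add_of_le_of_pos (Nat.ceil_le.1 hk) one_pos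
  obtain ⟨k, ⟨g, hg, hagree⟩, hk⟩ := ((hS ε hε (1 / ε)).and hlarge).exists
  have h1 : f (R.shift (-(x k + u k)) T) ∈ Metric.ball (f S) (1 / 2) := by
    refine hclose _ ⟨0, g, by simpa using hε.le, hg, ?_⟩
    rw [translate_zero]
    exact hagree
  have h2 : f (R.shift (-(y k + u k)) T) ∈ Metric.ball (f S) (1 / 2) := by
    refine hclose _ ⟨0, g, by simpa using hε.le, hg, ?_⟩
    rw [translate_zero]
    rintro t ⟨p, hpt, hp⟩
    refine (hagree t ⟨p, hpt, hp⟩).trans ?_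
    have hiff : ∀ Q : Set (R.Tile 0), t ∈ R.translate 0 g Q ↔ (t.1, t.2 - g) ∈ Q :=
      fun Q => R.mem_translate
    refine ((hiff _).trans ?_).trans (hiff _).symm
    -- the displacement by `g` costs at most `ε` of the radius
    refine agreeOn_of_mem_level hrec (hx k) (hy k) hk (hu k) _ ⟨p - g, ?_, ?_⟩
    · rw [mem_tileSupp] at hpt ⊢
      simpa only [sub_sub_sub_cancel_right] using hpt
    · rw [mem_closedBall_zero_iff] at hp ⊢
      exact (norm_sub_le _ _).trans (add_le_add hp hg)
  have h3 := dist_triangle_right (f (R.shift (-(x k + u k)) T)) (f (R.shift (-(y k + u k)) T)) (f S)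
  have h4 : dist (f (R.shift (-(x k + u k)) T)) (f (R.shift (-(y k + u k)) T)) =
      defect α (x k - y k) := by
    have h5 : ∀ v, (f (R.shift (-v) T) : ℂ) = phase α v * f T := hfα T
    refine (dist_eq_norm (f (R.shift (-(x k + u k)) T) : ℂ) _).trans ?_
    rw [h5, h5, ← sub_mul, norm_mul, Circle.norm_coe, mul_one, norm_phase_sub,
      add_sub_add_right_eq_sub]
  rw [Metric.mem_ball] at h1 h2
  have := hxy k
  linarith

/-! ### From an eigenfunction to summability -/

theorem neg_mem_returnVectors {n : ℕ} {v : Space d} (hv : v ∈ R.returnVectors n) :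
    -v ∈ R.returnVectors n := by
  obtain ⟨j, i, x, y, hx, hy, rfl⟩ := hv
  exact ⟨j, i, y, x, hy, hx, neg_sub y x⟩

/-- One return vector from every third level: an `(n+3)`-supertile contains the `(n+2)`-supertile
in which a given return vector of level `n` occurs, so the choices at the levels
`r, r + 3, r + 6, …` are independent, and the sum of such return vectors is the relative position
of two `r`-supertiles of the same type. -/
theorem exists_sum_returnVectors (hrec : R.Recognizable) (hprim : R.StronglyPrimitive)
    (T : R.TilingSpace 0) (r : ℕ) {W : ℕ → Space d} (hW : ∀ k, W k ∈ R.returnVectors (r + 3 * k)) :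
    ∀ (K : ℕ) (i : Fin (R.num (r + 3 * K))), ∃ (l : Fin (R.num r)) (a b : Space d),
      b - a = ∑ k ∈ Finset.range K, W k ∧ ∀ w, (i, w) ∈ (level hrec (r + 3 * K) T).1 →
        (l, w + a) ∈ (level hrec r T).1 ∧ (l, w + b) ∈ (level hrec r T).1
  | 0, i => ⟨i, 0, 0, by simp, fun w hw => by simpa using hw⟩
  | K + 1, i => by
    obtain ⟨j, i', x, y, hx, hy, hxy⟩ := hW K
    obtain ⟨l, a, b, hab, h⟩ := exists_sum_returnVectors hrec hprim T r hW K i'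
    obtain ⟨c, hc⟩ := hprim (r + 3 * K + 2) (by omega) i j
    refine ⟨l, c + x + a, c + y + b, ?_, fun w hw => ?_⟩
    · rw [Finset.sum_range_succ, ← hab, hxy]
      abel
    · have hj := mem_level_of_mem_parts hrec (n := r + 3 * K + 2) hw hc
      have h1 := (h _ (mem_level_of_mem_constituents hrec hj hx)).1
      have h2 := (h _ (mem_level_of_mem_constituents hrec hj hy)).2
      simp only [← add_assoc] at h1 h2 ⊢
      exact ⟨h1, h2⟩

theorem le_pi_div_three_of_norm_exp_sub_one_le {θ : ℝ} (h1 : θ ≤ Real.pi)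
    (h : ‖Complex.exp (Complex.I * θ) - 1‖ ≤ 1) : θ ≤ Real.pi / 3 := by
  by_contra! hlt
  rw [Complex.norm_exp_I_mul_ofReal_sub_one, Real.norm_eq_abs] at h
  have h2 : Real.sin (Real.pi / 6) < Real.sin (θ / 2) :=
    Real.sin_lt_sin_of_lt_of_le_pi_div_two (by linarith [Real.pi_pos]) (by linarith) (by linarith)
  rw [Real.sin_pi_div_six] at h2
  have := le_abs_self (2 * Real.sin (θ / 2))
  linarith

/-- Up to a sign of `v`, its phase has an argument in `[0, π]`. -/
theorem exists_phase_eq_exp (α v : Space d) : ∃ (w : Space d) (θ : ℝ), (w = v ∨ w = -v) ∧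
    0 ≤ θ ∧ θ ≤ Real.pi ∧ phase α w = Complex.exp (Complex.I * θ) := by
  have key : ∀ w, phase α w =
      Complex.exp (Complex.I * (2 * Real.pi * (inner ℝ α w - round (inner ℝ α w)) : ℝ)) := by
    intro w
    have h : Complex.I * ((2 * Real.pi * (inner ℝ α w - round (inner ℝ α w)) : ℝ) : ℂ) =
        2 * Real.pi * Complex.I * (inner ℝ α w : ℝ) -
          (round (inner ℝ α w : ℝ) : ℂ) * (2 * Real.pi * Complex.I) := by
      push_cast
      ring
    rw [h, Complex.exp_sub, Complex.exp_int_mul_two_pi_mul_I, div_one, phase]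
  have hround := abs_le.1 (abs_sub_round (inner ℝ α v))
  have hpi := Real.pi_pos
  rcases le_total 0 (inner ℝ α v - round (inner ℝ α v)) with h | h
  · exact ⟨v, _, Or.inl rfl, by positivity, by nlinarith, key v⟩
  · refine ⟨-v, 2 * Real.pi * -(inner ℝ α v - round (inner ℝ α v)), Or.inr rfl,
      mul_nonneg (by positivity) (by linarith), by nlinarith, ?_⟩
    have h1 : phase α (-v) * phase α v = 1 := by
      rw [← phase_add, neg_add_cancel, phase_zero]
    rw [eq_inv_of_mul_eq_one_left h1, key v, ← Complex.exp_neg]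
    congr 1
    push_cast
    ring

theorem phase_sum {W : ℕ → Space d} {θ : ℕ → ℝ} {α : Space d}
    (h : ∀ k, phase α (W k) = Complex.exp (Complex.I * θ k)) (K : ℕ) :
    phase α (∑ k ∈ Finset.range K, W k) =
      Complex.exp (Complex.I * (∑ k ∈ Finset.range K, θ k : ℝ)) := by
  induction K with
  | zero => simp [phase_zero]
  | succ K ih =>
    rw [Finset.sum_range_succ, Finset.sum_range_succ, phase_add, ih, h, ← Complex.exp_add]
    congr 1
    push_cast
    ring

/-- If the phases of all relative positions of supertiles of the same type and of level at least
`n₀` are at distance at most `1` from `1`, then `eta` has bounded sums over every third level. With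
signs chosen such that all arguments are nonnegative, the partial sums of the arguments advance by
steps of at most `π / 3` and stay in the arc of length `π / 3` next to `0` modulo `2π`; hence they
never leave `[0, π / 3]`. -/
theorem sum_eta_le (hrec : R.Recognizable) (hprim : R.StronglyPrimitive) (T : R.TilingSpace 0)
    {α : Space d} {n₀ : ℕ} (h : ∀ n ≥ n₀, ∀ (i : Fin (R.num n)) (x y : Space d),
      (i, x) ∈ (level hrec n T).1 → (i, y) ∈ (level hrec n T).1 → defect α (x - y) ≤ 1)
    {r : ℕ} (hr : n₀ ≤ r) (hr1 : 1 ≤ r) (K : ℕ) :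
    ∑ k ∈ Finset.range K, R.eta (r + 3 * k) α ≤ Real.pi / 3 := by
  choose v hv hveta using fun k => exists_defect_eq_eta (R := R) (r + 3 * k) α
  choose W θ hWv hθ0 hθpi hphase using fun k => exists_phase_eq_exp α (v k)
  have hW : ∀ k, W k ∈ R.returnVectors (r + 3 * k) := fun k => by
    rcases hWv k with h | h
    · exact h ▸ hv k
    · exact h ▸ neg_mem_returnVectors (hv k)
  have hsum : ∀ K, ‖Complex.exp (Complex.I * (∑ k ∈ Finset.range K, θ k : ℝ)) - 1‖ ≤ 1 := by
    intro K
    obtain ⟨w, hw⟩ := exists_mem_level hrec hprim T (n := r + 3 * K) (by omega) (R.baseType _)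
    obtain ⟨l, a, b, hab, hlev⟩ := exists_sum_returnVectors hrec hprim T r hW K (R.baseType _)
    have h1 := h r hr l _ _ (hlev w hw).2 (hlev w hw).1
    rwa [add_sub_add_left_eq_sub, hab, defect, phase_sum hphase] at h1
  have hdefect : ∀ k, defect α (W k) = R.eta (r + 3 * k) α := fun k => by
    rcases hWv k with h | h
    · rw [h, hveta]
    · rw [h, defect_neg, hveta]
  have hpi := Real.pi_pos
  have hstep : ∀ k, θ k ≤ Real.pi / 3 := by
    intro k
    refine le_pi_div_three_of_norm_exp_sub_one_le (hθpi k) ?_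
    have h0 : ‖phase α (W k) - 1‖ ≤ 1 := by
      obtain ⟨j, i, x, y, hx, hy, hxy⟩ := hW k
      obtain ⟨w, hw⟩ := exists_mem_level hrec hprim T (n := r + 3 * k + 2) (by omega) j
      have h1 := h (r + 3 * k) (by omega) i _ _ (mem_level_of_mem_constituents hrec hw hy)
        (mem_level_of_mem_constituents hrec hw hx)
      rwa [add_sub_add_left_eq_sub, ← hxy, defect] at h1
    rwa [hphase] at h0
  have hbound : ∀ K, ∑ k ∈ Finset.range K, θ k ≤ Real.pi / 3 := by
    intro K
    induction K with
    | zero => simpa using by positivity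
    | succ K ih =>
      refine le_pi_div_three_of_norm_exp_sub_one_le ?_ (hsum (K + 1))
      rw [Finset.sum_range_succ]
      linarith [hstep K]
  refine (Finset.sum_le_sum fun k _ => ?_).trans (hbound K)
  rw [← hdefect, defect, hphase]
  refine Real.norm_exp_I_mul_ofReal_sub_one_le.trans ?_
  rw [Real.norm_of_nonneg (hθ0 k)]

theorem IsTopologicalEigenvalue.summable_eta (hrec : R.Recognizable)
    (hprim : R.StronglyPrimitive) (hvH : R.VanHove) (hflc : R.FiniteLocalComplexity)
    (T : R.TilingSpace 0) {α : Space d} (hα : R.IsTopologicalEigenvalue α) :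
    Summable fun n => R.eta n α := by
  obtain ⟨n₀, h⟩ := hα.exists_defect_le_one hrec hvH hflc T
  have hsum := fun (r : ℕ) (hr : n₀ + 1 ≤ r) K =>
    sum_eta_le hrec hprim T h (by omega : n₀ ≤ r) (by omega) K
  refine (summable_nat_add_iff (n₀ + 1)).1
    (summable_of_sum_range_le (c := Real.pi) (fun n => eta_nonneg _ _) fun n => ?_)
  have hsplit : ∀ K, ∑ n ∈ Finset.range (3 * K), R.eta (n + (n₀ + 1)) α =
      ∑ k ∈ Finset.range K, R.eta (n₀ + 1 + 3 * k) α +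
        ∑ k ∈ Finset.range K, R.eta (n₀ + 2 + 3 * k) α +
        ∑ k ∈ Finset.range K, R.eta (n₀ + 3 + 3 * k) α := by
    intro K
    induction K with
    | zero => simp
    | succ K ih =>
      rw [show 3 * (K + 1) = 3 * K + 1 + 1 + 1 by ring]
      simp only [Finset.sum_range_succ]
      rw [ih, show 3 * K + (n₀ + 1) = n₀ + 1 + 3 * K by ring,
        show 3 * K + 1 + (n₀ + 1) = n₀ + 2 + 3 * K by ring,
        show 3 * K + 1 + 1 + (n₀ + 1) = n₀ + 3 + 3 * K by ring]
      ring
  calc ∑ k ∈ Finset.range n, R.eta (k + (n₀ + 1)) α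
      ≤ ∑ k ∈ Finset.range (3 * n), R.eta (k + (n₀ + 1)) α :=
        Finset.sum_le_sum_of_subset_of_nonneg (Finset.range_mono (by omega))
          fun _ _ _ => eta_nonneg _ _
    _ ≤ Real.pi := by
        rw [hsplit]
        linarith [hsum (n₀ + 1) (by omega) n, hsum (n₀ + 2) (by omega) n,
          hsum (n₀ + 3) (by omega) n]

end FusionRule

end

theorem mainTheorem2 {d : ℕ} (R : FusionRule d) (hne : Nonempty (R.TilingSpace 0))
    (hprim : R.StronglyPrimitive) (hrec : R.Recognizable) (hvH : R.VanHove)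
    (hflc : R.FiniteLocalComplexity) (α : Space d) :
    R.IsTopologicalEigenvalue α ↔ Summable (fun n : ℕ => R.eta n α) :=
  ⟨fun hα => hα.summable_eta hrec hprim hvH hflc hne.some,
    fun hs => FusionRule.isTopologicalEigenvalue_of_summable hrec hprim hs⟩
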